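/- Let $\mu>0$ and $0<q<1$, and consider global $C^2$ solutions $w:\mathbb R\to\mathbb R$ of $$w''+\mu w=w|w|^{q-1},\qquad (*)$$ where the right-hand side is $0$ when $w=0$. Call a solution \emph{of mode $k$}, $k\ge 1$ an integer, if its least positive period exists and equals $2\pi/k$; call it \emph{sign changing} if it takes both positive and negative values, \emph{positive} (\emph{nonnegative}) if $w(t)>0$ ($w(t)\ge 0$) for all $t$. Uniqueness is understood up to translations of the variable $t$. 1. Equation $(*)$ has a nonconstant sign-changing $2\pi$-periodic solution if and only if $\mu>1$. For each integer $k$ with $\frac{1-q}{2}\sqrt\mu<k<\sqrt\mu$ there is a sign-changing solution of mode $k$, and it is unique up to sign. 2. Equation $(*)$ has a nonconstant positive $2\pi$-periodic solution if and only if there is an integer $k$ with $(1-q)\sqrt\mu<k<\sqrt{\mu(1-q)}$. For an integer $k\ge1$, a positive solution of mode $k$ exists if and only if $(1-q)\sqrt\mu<k<\sqrt{\mu(1-q)}$, and in that case it is unique. 3. There is a unique nonnegative solution of $(*)$ with least positive period $L=\frac{2\pi}{(1-q)\sqrt\mu}$. It vanishes exactly once in each half-open interval of length $L$, and its orbit $\{(w(t),w'(t)):t\in\mathbb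 R\}$ is $$\Big\{(x,y)\in\mathbb R^2:\ x\ge 0,\ y^2+\mu x^2=\tfrac{2}{1+q}|x|^{1+q}\Big\}.$$ -/

import Mathlib

/-- `w : ℝ → ℝ` is a (classical, global) solution of `w'' + μ w = ε w |w|^(q-1)`. For `0 < q` the
right-hand side is `0` where `w` vanishes, also under the convention for `rpow` at base `0`. -/
def IsODESolution (μ ε q : ℝ) (w : ℝ → ℝ) : Prop :=
  ContDiff ℝ 2 w ∧ ∀ t : ℝ, deriv (deriv w) t + μ * w t = ε * (w t * |w t| ^ (q - 1))

/-- `T` is the least positive period of `w` (so `w`, if continuous, is not constant). -/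
def HasLeastPeriod (w : ℝ → ℝ) (T : ℝ) : Prop :=
  IsLeast {S : ℝ | 0 < S ∧ Function.Periodic w S} T

/-- `w` is of mode `k`: its least period is `2π/k` (never the case for `k = 0`). -/
def IsOfMode (w : ℝ → ℝ) (k : ℕ) : Prop :=
  HasLeastPeriod w (2 * Real.pi / k)

/-- `w` takes both positive and negative values. -/
def IsSignChanging (w : ℝ → ℝ) : Prop :=
  (∃ t : ℝ, 0 < w t) ∧ ∃ t : ℝ, w t < 0

/-- `w` is constant. -/
def IsConstantFun (w : ℝ → ℝ) : Prop :=
  ∃ a : ℝ, ∀ t : ℝ, w t = a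

/-- `v` is obtained from `w` by a shift of time. -/
def IsTimeShift (v w : ℝ → ℝ) : Prop :=
  ∃ τ : ℝ, ∀ t : ℝ, v t = w (t + τ)

/-- The orbit of `w` in the phase plane, i.e. the set of the points `(w(t), w'(t))`. -/
def phaseOrbit (w : ℝ → ℝ) : Set (ℝ × ℝ) :=
  Set.range fun t : ℝ => (w t, deriv w t)

namespace SublinearOscillator

open Set Filter Topology MeasureTheory

/-! If w solves the equation with μ = 1 and a^(1-q) = 1/μ, then a w(√μ t) solves it with coefficient
μ, so it suffices to treat μ = 1. There the energy E = w'²/2 + w²/2 - |w|^(1+q)/(1+q) is conserved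
and orbits lie on its level curves. A level E > 0 is one closed curve around the three equilibria 0,
1, -1; the level E = 0 is a figure eight through the origin; a level E < 0 consists of an oval
around 1 and one around -1, which shrink to points at the minimum.

The force is not Lipschitz at w = 0. Still, a phase point determines the solution as long as the
orbit avoids the origin (`eqOn_of_phase_ne_zero`): where w ≠ 0 the force is C¹, and where w' ≠ 0 the
energy relation is a first-order equation with C¹ right-hand side. Uniqueness can fail only at E =
0, where each loop of the eight takes finite time.

Closed orbits are parametrized by an angle, and the period becomes the integral over a full turn of
an inverse angular speed (`exists_solution_of_parametrization`).

For E > 0 and amplitude A, put w = A sin θ. Then θ' = √(1 - c Q(sin θ)) with c = 2A^(q-1)/(1+q) and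
Q(s) = (1-|s|^(1+q))/(1-s²). The integrand grows with c, so the period increases strictly from 2π (c
→ 0) to 4π/(1-q) (c → 1, that is E → 0). A sign-changing solution with E = 0 contains a whole loop
of each sign, so its periods are at least 4π/(1-q) and it adds no mode in the range considered
(`two_mul_bumpPeriod_le`).

For w > 0 and E < 0, the coordinate y = ±√(2(G(w) - G(1))), with G the potential, turns the ovals
into circles of radius r. With S its inverse, the period is the integral of S'(r sin θ). It
increases with r because S''(y) > -q/(3(1-q)) > S''(-y) for y > 0, the constant being the limit of
S'' at 0; this is `period_inequality`. The limits are 2π/√(1-q) from linearization at 1 and 2π/(1-q)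
from the loop E = 0.

The positive loop E = 0 is explicit: `bump` is a power of |sin|, and it is the nonnegative solution
with zeros. The conditions on k express that √μ · 2π/k lies in these period intervals. -/

/-- The potential energy `x² / 2 - |x|^(1+q) / (1+q)` of the equation `w'' + w = w |w|^(q-1)`. -/
noncomputable def potential (q x : ℝ) : ℝ := x ^ 2 / 2 - |x| ^ (1 + q) / (1 + q)

/-- The force `x |x|^(q-1) - x`. -/
noncomputable def force (q x : ℝ) : ℝ := x * |x| ^ (q - 1) - x

/-- The conserved energy of a solution. -/
noncomputable def energy (q x y : ℝ) : ℝ := y ^ 2 / 2 + potential q x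

/-! ### Potential and force -/

variable {q : ℝ}

lemma hasDerivAt_potential (hq : 0 < q) (x : ℝ) :
    HasDerivAt (potential q) (-force q x) x := by
  have h := (((hasDerivAt_id x).pow 2).div_const 2).sub
    ((hasDerivAt_abs_rpow x (p := 1 + q) (by linarith)).div_const (1 + q))
  refine h.congr_deriv ?_
  have h1 : 1 + q - 2 = q - 1 := by ring
  have h2 : 1 + q ≠ 0 := by positivity
  rw [h1, force]
  simp only [id, Nat.cast_ofNat]
  field_simp
  ring

lemma contDiff_potential (hq : 0 < q) : ContDiff ℝ 1 (potential q) := by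
  have h : ContDiff ℝ 1 (fun x : ℝ => ‖x‖ ^ (1 + q)) := contDiff_norm_rpow (by linarith)
  exact ((contDiff_id.pow 2).div_const 2).sub (h.div_const (1 + q))

lemma continuous_potential (hq : 0 < q) : Continuous (potential q) :=
  (contDiff_potential hq).continuous

lemma continuous_force (hq : 0 < q) : Continuous (force q) := by
  have h := (contDiff_potential hq).continuous_deriv le_rfl
  have h2 : deriv (potential q) = fun x => -force q x :=
    funext fun x => (hasDerivAt_potential hq x).deriv
  rw [h2] at h
  exact (continuous_neg_iff (f := force q)).1 h

lemma contDiffAt_force {x : ℝ} (hx : x ≠ 0) : ContDiffAt ℝ 1 (force q) x := by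
  have h : ContDiffAt ℝ 1 (fun x : ℝ => |x|) x := contDiffAt_abs hx
  exact (contDiffAt_id.mul (h.rpow_const_of_ne (abs_ne_zero.2 hx))).sub contDiffAt_id

@[simp] lemma potential_neg (x : ℝ) : potential q (-x) = potential q x := by
  simp [potential]

@[simp] lemma force_neg (x : ℝ) : force q (-x) = -force q x := by
  simp [force]; ring

lemma potential_zero (hq : 0 < q) : potential q 0 = 0 := by
  simp [potential, Real.zero_rpow (by linarith : 1 + q ≠ 0)]

lemma isODESolution_of_hasDerivAt (hq : 0 < q) {w z : ℝ → ℝ}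
    (hw : ∀ t, HasDerivAt w (z t) t) (hz : ∀ t, HasDerivAt z (force q (w t)) t) :
    IsODESolution 1 1 q w := by
  have h1 : deriv w = z := funext fun t => (hw t).deriv
  have h2 : deriv z = fun t => force q (w t) := funext fun t => (hz t).deriv
  have hc : Continuous w := continuous_iff_continuousAt.2 fun t => (hw t).continuousAt
  refine ⟨?_, fun t => ?_⟩
  · rw [show (2 : WithTop ℕ∞) = 1 + 1 by norm_num, contDiff_succ_iff_deriv]
    refine ⟨fun t => (hw t).differentiableAt, by simp, ?_⟩
    rw [h1, contDiff_one_iff_deriv, h2]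
    exact ⟨fun t => (hz t).differentiableAt, (continuous_force hq).comp hc⟩
  · rw [h1, h2]
    simp only [force]
    ring

/-! ### Conservation of energy and uniqueness away from the origin -/

section Solution

variable {v w : ℝ → ℝ}

lemma hasDerivAt_of_isODESolution (hw : IsODESolution 1 1 q w) (t : ℝ) :
    HasDerivAt w (deriv w t) t :=
  ((hw.1.differentiable (by norm_num)) t).hasDerivAt

lemma hasDerivAt_deriv_of_isODESolution (hw : IsODESolution 1 1 q w) (t : ℝ) :
    HasDerivAt (deriv w) (force q (w t)) t := by
  have h : ContDiff ℝ 1 (deriv w) := by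
    have := hw.1
    rw [show (2 : WithTop ℕ∞) = 1 + 1 by norm_num, contDiff_succ_iff_deriv] at this
    exact this.2.2
  refine ((h.differentiable (by norm_num)) t).hasDerivAt.congr_deriv ?_
  have := hw.2 t
  simp only [force]
  linarith

lemma continuous_deriv_of_isODESolution (hw : IsODESolution 1 1 q w) : Continuous (deriv w) :=
  continuous_iff_continuousAt.2 fun t => (hasDerivAt_deriv_of_isODESolution hw t).continuousAt

lemma isODESolution_shift (hq : 0 < q) (hw : IsODESolution 1 1 q w) (τ : ℝ) :
    IsODESolution 1 1 q (fun t => w (t + τ)) :=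
  isODESolution_of_hasDerivAt hq
    (fun t => (hasDerivAt_of_isODESolution hw (t + τ)).comp_add_const t τ)
    (fun t => (hasDerivAt_deriv_of_isODESolution hw (t + τ)).comp_add_const t τ)

lemma isODESolution_neg (hq : 0 < q) (hw : IsODESolution 1 1 q w) :
    IsODESolution 1 1 q (fun t => -w t) :=
  isODESolution_of_hasDerivAt hq (fun t => (hasDerivAt_of_isODESolution hw t).neg)
    (fun t => (hasDerivAt_deriv_of_isODESolution hw t).fun_neg.congr_deriv (force_neg _).symm)

lemma energy_eq (hq : 0 < q) (hw : IsODESolution 1 1 q w) (s t : ℝ) :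
    energy q (w s) (deriv w s) = energy q (w t) (deriv w t) := by
  have h : ∀ t, HasDerivAt (fun t => energy q (w t) (deriv w t)) 0 t := fun t => by
    have h1 := ((hasDerivAt_deriv_of_isODESolution hw t).pow 2).div_const 2
    have h2 := (hasDerivAt_potential hq (w t)).comp t (hasDerivAt_of_isODESolution hw t)
    refine (h1.add h2).congr_deriv ?_
    simp only [Nat.cast_ofNat]
    ring
  exact is_const_of_deriv_eq_zero (fun t => (h t).differentiableAt) (fun t => (h t).deriv) s t

/-- Off the line w = 0 the force is C¹, so the first-order system is locally Lipschitz and the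
standard uniqueness theorem applies. -/
lemma eventuallyEq_of_ne_zero (hv : IsODESolution 1 1 q v)
    (hw : IsODESolution 1 1 q w) {t : ℝ} (h0 : v t = w t) (h1 : deriv v t = deriv w t)
    (hne : w t ≠ 0) : v =ᶠ[𝓝 t] w := by
  let F : ℝ × ℝ → ℝ × ℝ := fun p => (p.2, force q p.1)
  have hF : ContDiffAt ℝ 1 F (w t, deriv w t) :=
    contDiffAt_snd.prodMk ((contDiffAt_force hne).comp (w t, deriv w t) contDiffAt_fst)
  obtain ⟨K, s, hs, hK⟩ := hF.exists_lipschitzOnWith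
  have key : ∀ u, IsODESolution 1 1 q u → u t = w t → deriv u t = deriv w t →
      ∀ᶠ x in 𝓝 t, HasDerivAt (fun x => (u x, deriv u x)) (F (u x, deriv u x)) x ∧
        (u x, deriv u x) ∈ s := by
    intro u hu e0 e1
    have hc : ContinuousAt (fun x => (u x, deriv u x)) t :=
      (hu.1.continuous.prodMk (continuous_deriv_of_isODESolution hu)).continuousAt
    have hs' : s ∈ 𝓝 (u t, deriv u t) := by rwa [e0, e1]
    filter_upwards [hc hs'] with x hx
    exact ⟨(hasDerivAt_of_isODESolution hu x).prodMk (hasDerivAt_deriv_of_isODESolution hu x), hx⟩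
  have := ODE_solution_unique_of_eventually (v := fun _ => F) (s := fun _ => s) (K := K)
    (Eventually.of_forall fun _ => hK) (key v hv h0 h1) (key w hw rfl rfl)
    (by simp [h0, h1])
  filter_upwards [this] with x hx
  exact congrArg Prod.fst hx

/-- Near a zero with positive velocity the equation reduces to `w' = √(2 (e - potential w))`, whose
right-hand side is Lipschitz although the force is not. -/
lemma eventuallyEq_of_deriv_pos (hq : 0 < q) (hv : IsODESolution 1 1 q v)
    (hw : IsODESolution 1 1 q w) {t : ℝ} (h0 : v t = w t) (h1 : deriv v t = deriv w t)
    (hne : 0 < deriv w t) : v =ᶠ[𝓝 t] w := by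
  let e := energy q (w t) (deriv w t)
  let F : ℝ → ℝ := fun x => √(2 * (e - potential q x))
  have hF : ContDiffAt ℝ 1 F (w t) := by
    refine ContDiffAt.sqrt ?_ ?_
    · exact contDiffAt_const.mul (contDiffAt_const.sub (contDiff_potential hq).contDiffAt)
    · simp only [e, energy]
      have : 0 < deriv w t ^ 2 := by positivity
      linarith
  obtain ⟨K, s, hs, hK⟩ := hF.exists_lipschitzOnWith
  have key : ∀ u, IsODESolution 1 1 q u → u t = w t → deriv u t = deriv w t →
      ∀ᶠ x in 𝓝 t, HasDerivAt u (F (u x)) x ∧ u x ∈ s := by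
    intro u hu e0 e1
    have hs' : s ∈ 𝓝 (u t) := by rwa [e0]
    have hpos : ∀ᶠ x in 𝓝 t, 0 < deriv u x :=
      (continuous_deriv_of_isODESolution hu).continuousAt.eventually
        (lt_mem_nhds (by rw [e1]; exact hne))
    filter_upwards [hu.1.continuous.continuousAt hs', hpos] with x hx hx2
    refine ⟨(hasDerivAt_of_isODESolution hu x).congr_deriv ?_, hx⟩
    have h3 : energy q (u x) (deriv u x) = e := by
      rw [energy_eq hq hu x t, e0, e1]
    simp only [F, ← h3, energy]
    rw [eq_comm, Real.sqrt_eq_iff_mul_self_eq_of_pos hx2]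
    ring
  exact ODE_solution_unique_of_eventually (v := fun _ => F) (s := fun _ => s) (K := K)
    (Eventually.of_forall fun _ => hK) (key v hv h0 h1) (key w hw rfl rfl) h0

/-- Negative velocity reduces to positive velocity by the symmetry w ↦ -w. The origin must be
excluded: `bump` and the zero solution meet there. -/
lemma eventuallyEq_of_phase_ne_zero (hq : 0 < q) (hv : IsODESolution 1 1 q v)
    (hw : IsODESolution 1 1 q w) {t : ℝ} (h0 : v t = w t) (h1 : deriv v t = deriv w t)
    (hne : w t ≠ 0 ∨ deriv w t ≠ 0) : v =ᶠ[𝓝 t] w := by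
  rcases hne with hne | hne
  · exact eventuallyEq_of_ne_zero hv hw h0 h1 hne
  · rcases hne.lt_or_gt with h | h
    · have hd : ∀ u : ℝ → ℝ, deriv (fun t => -u t) t = -deriv u t := fun u => deriv.fun_neg
      have := eventuallyEq_of_deriv_pos (t := t) hq (isODESolution_neg hq hv)
        (isODESolution_neg hq hw) (by rw [h0]) (by rw [hd, hd, h1]) (by rw [hd]; linarith)
      filter_upwards [this] with x hx
      exact neg_injective hx
    · exact eventuallyEq_of_deriv_pos hq hv hw h0 h1 h

/-- Two solutions through the same point of the phase plane agree as long as the orbit avoids the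
origin. -/
theorem eqOn_of_phase_ne_zero (hq : 0 < q) (hv : IsODESolution 1 1 q v)
    (hw : IsODESolution 1 1 q w) {s : Set ℝ} (hs : IsPreconnected s)
    (hne : ∀ t ∈ s, w t ≠ 0 ∨ deriv w t ≠ 0) {t₀ : ℝ} (ht₀ : t₀ ∈ s) (h0 : v t₀ = w t₀)
    (h1 : deriv v t₀ = deriv w t₀) : EqOn v w s := by
  -- The coincidence set in the phase plane is closed, and by local uniqueness it is a neighbourhood
  -- of each of its points in `s`; connectedness of `s` finishes.
  let Z : Set ℝ := {t | v t = w t ∧ deriv v t = deriv w t}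
  have hZc : IsClosed Z := (isClosed_eq hv.1.continuous hw.1.continuous).inter
    (isClosed_eq (continuous_deriv_of_isODESolution hv) (continuous_deriv_of_isODESolution hw))
  have hloc : ∀ t ∈ s, t ∈ Z → t ∈ interior Z := by
    intro t ht hZ
    rw [mem_interior_iff_mem_nhds]
    have h := eventuallyEq_of_phase_ne_zero hq hv hw hZ.1 hZ.2 (hne t ht)
    filter_upwards [h, h.deriv] with x hx hx'
    exact ⟨hx, hx'⟩
  have hsub : s ⊆ interior Z := by
    refine hs.subset_of_closure_inter_subset isOpen_interior ⟨t₀, ht₀, hloc t₀ ht₀ ⟨h0, h1⟩⟩ ?_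
    rintro t ⟨htc, hts⟩
    exact hloc t hts (hZc.closure_subset_iff.2 interior_subset htc)
  exact fun t ht => (interior_subset (hsub ht)).1

end Solution

/-! ### Periodic solutions from parametrized closed curves -/

/-- A positive continuous periodic function `g` is the inverse speed of a rotation: there is a
solution `θ` of `θ' = 1 / g(θ)` that advances by `2π` in the time `∫ g`. -/
lemma exists_rotation {g : ℝ → ℝ} (hg : Continuous g) (hpos : ∀ x, 0 < g x)
    (hper : Function.Periodic g (2 * Real.pi)) :
    ∃ θ : ℝ → ℝ, (∀ t, HasDerivAt θ (g (θ t))⁻¹ t) ∧ StrictMono θ ∧ Function.Surjective θ ∧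
      ∀ t, θ (t + ∫ x in (0)..(2 * Real.pi), g x) = θ t + 2 * Real.pi := by
  -- Time as a function of the angle; the rotation is its inverse.
  let τ : ℝ → ℝ := fun s => ∫ x in (0)..s, g x
  have hint : ∀ a b, IntervalIntegrable g volume a b := fun a b => hg.intervalIntegrable a b
  have hτ : ∀ s, HasDerivAt τ (g s) s := fun s =>
    intervalIntegral.integral_hasDerivAt_right (hint 0 s)
      hg.aestronglyMeasurable.stronglyMeasurableAtFilter hg.continuousAt
  have hmono : StrictMono τ := strictMono_of_hasDerivAt_pos hτ hpos
  have hcont : Continuous τ := continuous_iff_continuousAt.2 fun s => (hτ s).continuousAt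
  have h2pi : 0 < 2 * Real.pi := by positivity
  have hT : 0 < ∫ x in (0)..(2 * Real.pi), g x :=
    intervalIntegral.intervalIntegral_pos_of_pos_on (hint _ _) (fun x _ => hpos x) h2pi
  have hsurj : Function.Surjective τ :=
    hcont.surjective
      (hper.tendsto_atTop_intervalIntegral_of_pos hT h2pi)
      (hper.tendsto_atBot_intervalIntegral_of_pos hT h2pi)
  have hadd : ∀ s, τ (s + 2 * Real.pi) = τ s + τ (2 * Real.pi) := fun s => by
    simp only [τ]
    rw [← intervalIntegral.integral_add_adjacent_intervals (hint 0 s) (hint s _),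
      hper.intervalIntegral_add_eq s 0, zero_add]
  let e := hmono.orderIsoOfSurjective τ hsurj
  have he : ∀ s, e s = τ s := fun s => rfl
  refine ⟨e.symm, fun t => ?_, e.symm.strictMono, e.symm.surjective, fun t => ?_⟩
  · refine HasDerivAt.of_local_left_inverse e.symm.continuous.continuousAt (hτ _)
      (hpos _).ne' (Eventually.of_forall fun y => ?_)
    exact e.apply_symm_apply y
  · apply e.injective
    rw [e.apply_symm_apply, he, hadd, ← he, e.apply_symm_apply]

/-- A parametrized closed curve in the phase plane, run through with the speed `1 / g`, gives a
periodic solution of period `∫ g`. -/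
theorem exists_solution_of_parametrization (hq : 0 < q) {g Φ Ψ : ℝ → ℝ} (hg : Continuous g)
    (hpos : ∀ x, 0 < g x) (hper : Function.Periodic g (2 * Real.pi))
    (hΦ : ∀ x, HasDerivAt Φ (Ψ x * g x) x) (hΨ : ∀ x, HasDerivAt Ψ (force q (Φ x) * g x) x)
    (hΦper : Function.Periodic Φ (2 * Real.pi))
    (hmax : ∀ x, Φ x = Φ (Real.pi / 2) → ∃ n : ℤ, x = Real.pi / 2 + n * (2 * Real.pi)) :
    ∃ w : ℝ → ℝ, IsODESolution 1 1 q w ∧ (∀ x, ∃ t, w t = Φ x ∧ deriv w t = Ψ x) ∧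
      (∀ t, ∃ x, w t = Φ x ∧ deriv w t = Ψ x) ∧
      Function.Periodic w (∫ x in (0)..(2 * Real.pi), g x) ∧
      ∀ S, 0 < S → Function.Periodic w S →
        ∃ n : ℕ, 1 ≤ n ∧ S = n * ∫ x in (0)..(2 * Real.pi), g x := by
  obtain ⟨θ, hθ, hmono, hsurj, hadd⟩ := exists_rotation hg hpos hper
  set T := ∫ x in (0)..(2 * Real.pi), g x with hTdef
  have hw : ∀ t, HasDerivAt (fun t => Φ (θ t)) (Ψ (θ t)) t := fun t => by
    refine ((hΦ (θ t)).comp t (hθ t)).congr_deriv ?_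
    field_simp [(hpos (θ t)).ne']
  have hz : ∀ t, HasDerivAt (fun t => Ψ (θ t)) (force q (Φ (θ t))) t := fun t => by
    refine ((hΨ (θ t)).comp t (hθ t)).congr_deriv ?_
    field_simp [(hpos (θ t)).ne']
  have hdw : ∀ t, deriv (fun t => Φ (θ t)) t = Ψ (θ t) := fun t => (hw t).deriv
  refine ⟨fun t => Φ (θ t), isODESolution_of_hasDerivAt hq hw hz, fun x => ?_,
    fun t => ⟨θ t, rfl, hdw t⟩, fun t => ?_, fun S hS hSper => ?_⟩
  · obtain ⟨t, rfl⟩ := hsurj x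
    exact ⟨t, rfl, hdw t⟩
  · simp only [hadd, hΦper (θ t)]
  -- Start where Φ takes its value at π/2, which recurs only after whole turns. A period S brings
  -- that value back, so θ has made n whole turns, and n > 0 because θ increases.
  · obtain ⟨t, ht⟩ := hsurj (Real.pi / 2)
    obtain ⟨n, hn⟩ := hmax (θ (t + S)) (by rw [← ht]; exact hSper t)
    have hlt : θ t < θ (t + S) := hmono (by linarith)
    rw [hn, ht] at hlt
    have hnpos : 0 < n := by
      have h0 : 0 < (n : ℝ) * (2 * Real.pi) := by linarith
      have h1 : 0 < (n : ℝ) := pos_of_mul_pos_left h0 (by positivity)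
      exact_mod_cast h1
    obtain ⟨m, rfl⟩ := Int.eq_ofNat_of_zero_le hnpos.le
    have hmul : ∀ m : ℕ, θ (t + m * T) = θ t + m * (2 * Real.pi) := by
      intro m
      induction m with
      | zero => simp
      | succ k ih =>
        push_cast
        rw [show t + ((k : ℝ) + 1) * T = t + k * T + T by ring, hadd, ih]
        ring
    refine ⟨m, by omega, ?_⟩
    have : θ (t + S) = θ (t + m * T) := by
      rw [hn, hmul, ht]
      simp
    linarith [hmono.injective this]

/-! ### Integral tools -/

/-- The integral of a function with the symmetry of the sine over a full period. -/
lemma integral_eq_two_mul_of_sine_symmetry {g : ℝ → ℝ} (hg : Continuous g)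
    (hper : Function.Periodic g (2 * Real.pi)) (hsymm : ∀ x, g (Real.pi - x) = g x) :
    ∫ x in (0)..(2 * Real.pi), g x = 2 * ∫ x in (0)..(Real.pi / 2), (g x + g (-x)) := by
  have hint : ∀ a b, IntervalIntegrable g volume a b := fun a b => hg.intervalIntegrable a b
  -- Move the period to [-π/2, 3π/2]; the reflection x ↦ π - x folds its second half onto the first.
  have h1 : ∫ x in (0)..(2 * Real.pi), g x
      = ∫ x in (-(Real.pi / 2))..(-(Real.pi / 2) + 2 * Real.pi), g x := by
    rw [hper.intervalIntegral_add_eq _ 0, zero_add]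
  have h2 : ∫ x in (Real.pi / 2)..(-(Real.pi / 2) + 2 * Real.pi), g x
      = ∫ x in (-(Real.pi / 2))..(Real.pi / 2), g x := by
    have := intervalIntegral.integral_comp_sub_left (a := -(Real.pi / 2)) (b := Real.pi / 2) g
      Real.pi
    simp only [hsymm] at this
    rw [this]
    congr 1 <;> ring
  have h3 : ∫ x in (-(Real.pi / 2))..0, g x = ∫ x in (0)..(Real.pi / 2), g (-x) := by
    rw [intervalIntegral.integral_comp_neg, neg_zero]
  rw [h1, ← intervalIntegral.integral_add_adjacent_intervals (hint _ (Real.pi / 2)) (hint _ _), h2,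
    ← intervalIntegral.integral_add_adjacent_intervals (hint _ 0) (hint 0 _), h3,
    intervalIntegral.integral_add (hint _ _)
      (Continuous.intervalIntegrable (by fun_prop) _ _)]
  ring

/-- A family of nonnegative functions that increases with the parameter and is integrable for the
largest value of the parameter has a continuous, strictly increasing integral. -/
theorem integral_strictMonoOn_continuousOn {p : ℝ → ℝ → ℝ} {a b α β : ℝ} (hαβ : α < β)
    (hab : a ≤ b)
    (hmono : ∀ x ∈ Ioo α β, StrictMonoOn (fun c => p c x) (Icc a b))
    (hcont : ∀ x ∈ Ioo α β, ContinuousOn (fun c => p c x) (Icc a b))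
    (hmeas : ∀ c ∈ Icc a b, ContinuousOn (p c) (Ioo α β))
    (hnn : ∀ x ∈ Ioo α β, 0 ≤ p a x) (hint : IntervalIntegrable (p b) volume α β) :
    StrictMonoOn (fun c => ∫ x in α..β, p c x) (Icc a b) ∧
      ContinuousOn (fun c => ∫ x in α..β, p c x) (Icc a b) := by
  have hbint : IntegrableOn (p b) (Ioo α β) :=
    (intervalIntegrable_iff_integrableOn_Ioo_of_le hαβ.le).1 hint
  have hae : ∀ c ∈ Icc a b, AEStronglyMeasurable (p c) (volume.restrict (Ioo α β)) :=
    fun c hc => (hmeas c hc).aestronglyMeasurable measurableSet_Ioo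
  have hbound : ∀ c ∈ Icc a b, ∀ x ∈ Ioo α β, ‖p c x‖ ≤ p b x := fun c hc x hx => by
    have h1 := (hmono x hx).monotoneOn ⟨le_rfl, hab⟩ hc hc.1
    have h2 := (hmono x hx).monotoneOn hc ⟨hab, le_rfl⟩ hc.2
    rw [Real.norm_of_nonneg ((hnn x hx).trans h1)]
    exact h2
  have hint' : ∀ c ∈ Icc a b, IntegrableOn (p c) (Ioo α β) := fun c hc =>
    Integrable.mono' hbint (hae c hc)
      ((ae_restrict_iff' measurableSet_Ioo).2 (Eventually.of_forall (hbound c hc)))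
  have hii : ∀ c ∈ Icc a b, IntervalIntegrable (p c) volume α β := fun c hc =>
    (intervalIntegrable_iff_integrableOn_Ioo_of_le hαβ.le).2 (hint' c hc)
  constructor
  · intro c hc d hd hcd
    have h := intervalIntegral.intervalIntegral_pos_of_pos_on
      ((hii d hd).sub (hii c hc)) (fun x hx => sub_pos.2 (hmono x hx hc hd hcd)) hαβ
    rw [intervalIntegral.integral_sub (hii d hd) (hii c hc)] at h
    simpa using h
  · have heq : (fun c => ∫ x in α..β, p c x) = fun c => ∫ x in Ioo α β, p c x := by
      funext c
      rw [intervalIntegral.integral_of_le hαβ.le, integral_Ioc_eq_integral_Ioo]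
    rw [heq]
    intro c hc
    refine continuousWithinAt_of_dominated (bound := p b) ?_ ?_ hbint ?_
    · filter_upwards [self_mem_nhdsWithin] with d hd using hae d hd
    · filter_upwards [self_mem_nhdsWithin] with d hd
      exact (ae_restrict_iff' measurableSet_Ioo).2 (Eventually.of_forall (hbound d hd))
    · exact (ae_restrict_iff' measurableSet_Ioo).2
        (Eventually.of_forall fun x hx => hcont x hx c hc)

/-- The fundamental theorem of calculus for a nonnegative, possibly unbounded derivative. -/
lemma integrable_and_integral_of_deriv_nonneg {F f : ℝ → ℝ} {α β : ℝ} (hαβ : α ≤ β)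
    (hF : ContinuousOn F (Icc α β)) (hd : ∀ x ∈ Ioo α β, HasDerivAt F (f x) x)
    (hnn : ∀ x ∈ Ioo α β, 0 ≤ f x) :
    IntervalIntegrable f volume α β ∧ ∫ x in α..β, f x = F β - F α := by
  have hint : IntervalIntegrable f volume α β := by
    refine intervalIntegral.intervalIntegrable_deriv_of_nonneg (g := F) ?_ ?_ ?_
    · rwa [uIcc_of_le hαβ]
    · rwa [min_eq_left hαβ, max_eq_right hαβ]
    · rwa [min_eq_left hαβ, max_eq_right hαβ]
  exact ⟨hint, intervalIntegral.integral_eq_sub_of_hasDerivAt_of_le hαβ hF hd hint⟩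

/-! ### Angular speed and period of the sign-changing oscillations -/

/-- The quotient `(1 - |s|^(1+q)) / (1 - s²)`, extended by continuity to `s = ±1`. -/
noncomputable def powQuotient (q s : ℝ) : ℝ := dslope (fun x : ℝ => x ^ ((1 + q) / 2)) 1 (s ^ 2)

lemma sq_rpow_half (s : ℝ) : (s ^ 2) ^ ((1 + q) / 2) = |s| ^ (1 + q) := by
  rw [← sq_abs, ← Real.rpow_natCast, ← Real.rpow_mul (abs_nonneg s)]
  congr 1
  push_cast
  ring

lemma one_sub_sq_mul_powQuotient (s : ℝ) :
    (1 - s ^ 2) * powQuotient q s = 1 - |s| ^ (1 + q) := by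
  have h := sub_smul_dslope (fun x : ℝ => x ^ ((1 + q) / 2)) 1 (s ^ 2)
  simp only [smul_eq_mul, Real.one_rpow, sq_rpow_half] at h
  rw [powQuotient]
  linarith

lemma continuous_powQuotient (hq : 0 < q) : Continuous (powQuotient q) := by
  have h : Continuous (dslope (fun x : ℝ => x ^ ((1 + q) / 2)) 1) := by
    rw [← continuousOn_univ, continuousOn_dslope univ_mem]
    refine ⟨(Real.continuous_rpow_const (by positivity)).continuousOn, ?_⟩
    exact (Real.hasDerivAt_rpow_const (Or.inl one_ne_zero)).differentiableAt
  exact h.comp (continuous_pow 2)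

lemma powQuotient_of_sq_eq_one {s : ℝ} (hs : s ^ 2 = 1) : powQuotient q s = (1 + q) / 2 := by
  rw [powQuotient, hs, dslope_same,
    (Real.hasDerivAt_rpow_const (p := (1 + q) / 2) (Or.inl one_ne_zero)).deriv]
  simp

/-- Because 1 + q < 2, one has s² < s^(1+q) < 1 on (0, 1). -/
lemma powQuotient_mem_Ioo (hq0 : 0 < q) (hq1 : q < 1) {s : ℝ} (h0 : 0 < s) (h1 : s < 1) :
    powQuotient q s ∈ Ioo 0 1 := by
  have h := one_sub_sq_mul_powQuotient (q := q) s
  have hs : 0 < 1 - s ^ 2 := by nlinarith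
  rw [abs_of_pos h0] at h
  have hr1 : s ^ (1 + q) < 1 := Real.rpow_lt_one h0.le h1 (by linarith)
  have hr2 : s ^ 2 < s ^ (1 + q) := by
    rw [← Real.rpow_natCast]
    exact Real.rpow_lt_rpow_of_exponent_gt h0 h1 (by push_cast; linarith)
  constructor
  · exact pos_of_mul_pos_right (by rw [h]; linarith) hs.le
  · by_contra! hc
    nlinarith

lemma powQuotient_mem_Ioc (hq0 : 0 < q) (hq1 : q < 1) {s : ℝ} (hs : s ^ 2 ≤ 1) :
    powQuotient q s ∈ Ioc 0 1 := by
  rcases hs.eq_or_lt with h | h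
  · rw [powQuotient_of_sq_eq_one h]
    constructor <;> linarith
  · have habs : powQuotient q s = powQuotient q |s| := by simp [powQuotient]
    rcases (abs_nonneg s).eq_or_lt with h0 | h0
    · have h2 := one_sub_sq_mul_powQuotient (q := q) s
      rw [abs_eq_zero.1 h0.symm] at h2 ⊢
      rw [abs_zero, Real.zero_rpow (by linarith)] at h2
      constructor <;> linarith
    · rw [habs]
      exact Ioo_subset_Ioc_self (powQuotient_mem_Ioo hq0 hq1 h0 ((sq_lt_one_iff_abs_lt_one s).1 h))

/-- The squared angular speed of the sign-changing solutions. -/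
noncomputable def signSpeed (q c x : ℝ) : ℝ := 1 - c * powQuotient q (Real.sin x)

lemma signSpeed_pos (hq0 : 0 < q) (hq1 : q < 1) {c : ℝ} (hc0 : 0 ≤ c) (hc1 : c < 1) (x : ℝ) :
    0 < signSpeed q c x := by
  have h := powQuotient_mem_Ioc hq0 hq1 (Real.sin_sq_le_one x)
  rw [signSpeed]
  nlinarith [h.1, h.2]

lemma continuous_signSpeed (hq0 : 0 < q) (c : ℝ) : Continuous (signSpeed q c) := by
  unfold signSpeed
  have := (continuous_powQuotient hq0).comp Real.continuous_sin
  exact continuous_const.sub (continuous_const.mul this)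

/-- This is the squared velocity up to the factor A². Its right-hand side is visibly C¹, while
`powQuotient` is only shown to be continuous at s = ±1. -/
lemma cos_sq_mul_signSpeed (c x : ℝ) :
    Real.cos x ^ 2 * signSpeed q c x = Real.cos x ^ 2 - c * (1 - |Real.sin x| ^ (1 + q)) := by
  have h := one_sub_sq_mul_powQuotient (q := q) (Real.sin x)
  rw [signSpeed, ← h, ← Real.cos_sq']
  ring

/-- At a zero of the first factor, the second factor need only be continuous. -/
lemma hasDerivAt_mul_of_eq_zero {u v : ℝ → ℝ} {u' x : ℝ} (hu : HasDerivAt u u' x) (h0 : u x = 0)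
    (hv : ContinuousAt v x) : HasDerivAt (fun y => u y * v y) (u' * v x) x := by
  rw [hasDerivAt_iff_tendsto_slope] at hu ⊢
  refine (hu.mul (hv.tendsto.mono_left nhdsWithin_le_nhds)).congr fun y => ?_
  simp only [slope_def_field, h0]
  ring

/-- The second half of the first-order system for the curve (A sin x, A cos x √speed). Turning
points need separate care: where cos vanishes, continuity of the other factor is enough, and the
limit (1+q)/2 of `powQuotient` gives the right value. -/
lemma hasDerivAt_cos_mul_sqrt_signSpeed (hq0 : 0 < q) (hq1 : q < 1) {c : ℝ} (hc0 : 0 ≤ c)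
    (hc1 : c < 1) (x : ℝ) :
    HasDerivAt (fun x => Real.cos x * √(signSpeed q c x))
      (Real.sin x * ((1 + q) / 2 * c * |Real.sin x| ^ (q - 1) - 1) * (√(signSpeed q c x))⁻¹) x := by
  have hpos := signSpeed_pos hq0 hq1 hc0 hc1 x
  have hsq := Real.sq_sqrt hpos.le
  have hsne : √(signSpeed q c x) ≠ 0 := (Real.sqrt_pos.2 hpos).ne'
  by_cases hcos : Real.cos x = 0
  · have hs : Real.sin x ^ 2 = 1 := by
      have := Real.sin_sq_add_cos_sq x
      rw [hcos] at this
      linarith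
    have habs : |Real.sin x| = 1 := by
      rw [← sq_abs] at hs
      nlinarith [abs_nonneg (Real.sin x)]
    refine (hasDerivAt_mul_of_eq_zero (Real.hasDerivAt_cos x) hcos
      (continuous_signSpeed hq0 c).sqrt.continuousAt).congr_deriv ?_
    rw [habs, Real.one_rpow, eq_mul_inv_iff_mul_eq₀ hsne, mul_assoc, ← sq, hsq, signSpeed,
      powQuotient_of_sq_eq_one hs]
    ring
  -- Away from the turning points the speed is M / cos², a quotient of differentiable functions.
  · let M : ℝ → ℝ := fun x => Real.cos x ^ 2 - c * (1 - |Real.sin x| ^ (1 + q))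
    have hM : HasDerivAt M (2 * Real.cos x * (-Real.sin x)
        + c * ((1 + q) * |Real.sin x| ^ (q - 1) * Real.sin x * Real.cos x)) x := by
      have h1 := (Real.hasDerivAt_cos x).pow 2
      have h2 := (hasDerivAt_abs_rpow (Real.sin x) (p := 1 + q) (by linarith)).comp x
        (Real.hasDerivAt_sin x)
      refine (h1.sub ((h2.const_sub 1).const_mul c)).congr_deriv ?_
      rw [show 1 + q - 2 = q - 1 by ring]
      simp
    have hK : HasDerivAt (signSpeed q c) _ x :=
      (hM.div ((Real.hasDerivAt_cos x).pow 2) (pow_ne_zero 2 hcos)).congr_of_eventuallyEq (by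
        filter_upwards [Real.continuous_cos.continuousAt.eventually_ne hcos] with y hy
        have := cos_sq_mul_signSpeed (q := q) c y
        rw [Pi.div_apply, Pi.pow_apply, eq_div_iff (pow_ne_zero 2 hy)]
        simp only [M]
        linarith)
    refine ((Real.hasDerivAt_cos x).mul (hK.sqrt hpos.ne')).congr_deriv ?_
    have hMx : M x = Real.cos x ^ 2 * signSpeed q c x := (cos_sq_mul_signSpeed c x).symm
    rw [hMx]
    generalize √(signSpeed q c x) = R at *
    rw [← hsq]
    field_simp
    simp
    ring

/-- A quarter of the period of the sign-changing solution with parameter `c`. -/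
noncomputable def signQuarterPeriod (q c : ℝ) : ℝ :=
  ∫ x in (0)..(Real.pi / 2), (√(signSpeed q c x))⁻¹

lemma integral_inv_sqrt_signSpeed (hq0 : 0 < q) (hq1 : q < 1) {c : ℝ} (hc0 : 0 ≤ c)
    (hc1 : c < 1) :
    ∫ x in (0)..(2 * Real.pi), (√(signSpeed q c x))⁻¹ = 4 * signQuarterPeriod q c := by
  have hcont : Continuous fun x => (√(signSpeed q c x))⁻¹ :=
    (continuous_signSpeed hq0 c).sqrt.inv₀
      fun x => (Real.sqrt_pos.2 (signSpeed_pos hq0 hq1 hc0 hc1 x)).ne'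
  rw [integral_eq_two_mul_of_sine_symmetry hcont (fun x => by simp [signSpeed])
    (fun x => by simp [signSpeed])]
  have h : ∀ x, signSpeed q c (-x) = signSpeed q c x := fun x => by simp [signSpeed, powQuotient]
  simp only [h, ← two_mul]
  rw [intervalIntegral.integral_const_mul, signQuarterPeriod]
  ring

lemma sin_mem_Ioo {x : ℝ} (hx : x ∈ Ioo 0 (Real.pi / 2)) : Real.sin x ∈ Ioo (0 : ℝ) 1 := by
  refine ⟨Real.sin_pos_of_pos_of_lt_pi hx.1 (by linarith [hx.2, Real.pi_pos]), ?_⟩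
  rw [← Real.sin_pi_div_two]
  exact Real.strictMonoOn_sin ⟨by linarith [hx.1, Real.pi_pos], hx.2.le⟩
    ⟨by linarith [Real.pi_pos], le_rfl⟩ hx.2

/-- At c = 1, cos² · speed = s^(1+q) - s² = s^(1+q)(1 - s^(1-q)) with s = sin x. With u =
s^((1-q)/2) the inverse root becomes a multiple of u'/√(1-u²), which integrates to an arcsine. -/
lemma signSpeed_one_eq {x : ℝ} (hx : x ∈ Ioo 0 (Real.pi / 2)) :
    (√(signSpeed q 1 x))⁻¹ = Real.sin x ^ ((1 - q) / 2 - 1) * Real.cos x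
      * (√(1 - (Real.sin x ^ ((1 - q) / 2)) ^ 2))⁻¹ := by
  obtain ⟨h0, -⟩ := sin_mem_Ioo hx
  have hcos : 0 < Real.cos x := Real.cos_pos_of_mem_Ioo ⟨by linarith [hx.1, Real.pi_pos], hx.2⟩
  have h := cos_sq_mul_signSpeed (q := q) 1 x
  have e1 : (Real.sin x ^ ((1 - q) / 2)) ^ 2 = Real.sin x ^ (1 - q) := by
    rw [← Real.rpow_natCast, ← Real.rpow_mul h0.le]
    congr 1
    push_cast
    ring
  have e2 : Real.sin x ^ (1 + q) * Real.sin x ^ (1 - q) = Real.sin x ^ 2 := by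
    rw [← Real.rpow_add h0, ← Real.rpow_natCast]
    congr 1
    push_cast
    ring
  have e3 : (Real.sin x ^ ((1 - q) / 2 - 1))⁻¹ ^ 2 = Real.sin x ^ (1 + q) := by
    rw [← Real.rpow_neg h0.le, ← Real.rpow_natCast, ← Real.rpow_mul h0.le]
    congr 1
    push_cast
    ring
  have e4 : signSpeed q 1 x = ((Real.sin x ^ ((1 - q) / 2 - 1))⁻¹ / Real.cos x) ^ 2
      * (1 - Real.sin x ^ (1 - q)) := by
    rw [div_pow, e3, div_mul_eq_mul_div, eq_div_iff (by positivity), mul_comm (signSpeed q 1 x), h,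
      abs_of_pos h0, Real.cos_sq']
    linear_combination e2
  have hpos : 0 < Real.sin x ^ ((1 - q) / 2 - 1) := Real.rpow_pos_of_pos h0 _
  rw [e1, e4, Real.sqrt_mul (sq_nonneg _), Real.sqrt_sq (by positivity), mul_inv, inv_div,
    div_inv_eq_mul]
  ring

/-- The integral is improper: `powQuotient` is 1 at s = 0, so for c = 1 the speed vanishes there. -/
lemma signQuarterPeriod_one (hq1 : q < 1) :
    IntervalIntegrable (fun x => (√(signSpeed q 1 x))⁻¹) volume 0 (Real.pi / 2) ∧
      signQuarterPeriod q 1 = Real.pi / (1 - q) := by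
  have hδ : 0 < (1 - q) / 2 := by linarith
  let F : ℝ → ℝ := fun x => 2 / (1 - q) * Real.arcsin (Real.sin x ^ ((1 - q) / 2))
  have hF : Continuous F :=
    continuous_const.mul (Real.continuous_arcsin.comp
      ((Real.continuous_rpow_const hδ.le).comp Real.continuous_sin))
  have hd : ∀ x ∈ Ioo 0 (Real.pi / 2), HasDerivAt F (√(signSpeed q 1 x))⁻¹ x := fun x hx => by
    obtain ⟨h0, h1⟩ := sin_mem_Ioo hx
    have hu0 : 0 < Real.sin x ^ ((1 - q) / 2) := Real.rpow_pos_of_pos h0 _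
    have hu1 : Real.sin x ^ ((1 - q) / 2) < 1 := Real.rpow_lt_one h0.le h1 hδ
    have hu := (Real.hasDerivAt_sin x).rpow_const (p := (1 - q) / 2) (Or.inl h0.ne')
    have := (Real.hasDerivAt_arcsin (by linarith) hu1.ne).comp x hu
    refine (this.const_mul (2 / (1 - q))).congr_deriv ?_
    rw [signSpeed_one_eq hx]
    have : 1 - q ≠ 0 := by linarith
    field_simp
  obtain ⟨h1, h2⟩ := integrable_and_integral_of_deriv_nonneg (by positivity) hF.continuousOn hd
    (fun x _ => by positivity)
  refine ⟨h1, ?_⟩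
  rw [signQuarterPeriod, h2]
  simp only [F, Real.sin_pi_div_two, Real.sin_zero, Real.one_rpow, Real.zero_rpow hδ.ne',
    Real.arcsin_one, Real.arcsin_zero]
  have : 1 - q ≠ 0 := by linarith
  field_simp
  ring

lemma signQuarterPeriod_zero : signQuarterPeriod q 0 = Real.pi / 2 := by
  simp [signQuarterPeriod, signSpeed]

/-- The speed decreases in c pointwise, and the integrable case c = 1 dominates all others. -/
lemma signQuarterPeriod_strictMonoOn_continuousOn (hq0 : 0 < q) (hq1 : q < 1) :
    StrictMonoOn (signQuarterPeriod q) (Icc 0 1) ∧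
      ContinuousOn (signQuarterPeriod q) (Icc 0 1) := by
  have hpos : ∀ x ∈ Ioo 0 (Real.pi / 2), ∀ c ∈ Icc (0 : ℝ) 1, 0 < signSpeed q c x := by
    intro x hx c hc
    obtain ⟨h0, h1⟩ := sin_mem_Ioo hx
    have h := powQuotient_mem_Ioo hq0 hq1 h0 h1
    rw [signSpeed]
    nlinarith [h.1, h.2, hc.1, hc.2]
  refine integral_strictMonoOn_continuousOn (p := fun c x => (√(signSpeed q c x))⁻¹)
    (by positivity) zero_le_one ?_ ?_ ?_ (fun x _ => by positivity)
    (signQuarterPeriod_one hq1).1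
  · intro x hx c hc d hd hcd
    obtain ⟨h0, h1⟩ := sin_mem_Ioo hx
    have h := powQuotient_mem_Ioo hq0 hq1 h0 h1
    have hp := hpos x hx d hd
    refine inv_strictAnti₀ (Real.sqrt_pos.2 hp) (Real.sqrt_lt_sqrt hp.le ?_)
    simp only [signSpeed]
    nlinarith [h.1]
  · intro x hx
    refine ContinuousOn.inv₀ (ContinuousOn.sqrt ?_)
      fun c hc => (Real.sqrt_pos.2 (hpos x hx c hc)).ne'
    unfold signSpeed
    fun_prop
  · intro c hc
    exact ContinuousOn.inv₀ (continuous_signSpeed hq0 c).sqrt.continuousOn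
      fun x hx => (Real.sqrt_pos.2 (hpos x hx c hc)).ne'

/-! ### Existence of sign-changing oscillations -/

/-- The parameter `2 A^(q-1) / (1+q)` of the oscillation of amplitude `A`. -/
noncomputable def amplitudeParam (q A : ℝ) : ℝ := 2 / (1 + q) * A ^ (q - 1)

/-- Scaling by A puts the amplitude into the single parameter c. At s = 0 it reads 2 G(A) = A²(1 -
c), G being the potential, so c < 1 means positive energy. -/
lemma potential_amplitude_sub (hq0 : 0 < q) {A : ℝ} (hA : 0 < A) (s : ℝ) :
    2 * (potential q A - potential q (A * s))
      = A ^ 2 * ((1 - s ^ 2) - amplitudeParam q A * (1 - |s| ^ (1 + q))) := by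
  have h : A ^ (1 + q) = A ^ 2 * A ^ (q - 1) := by
    rw [← Real.rpow_natCast, ← Real.rpow_add hA]
    congr 1
    push_cast
    ring
  have hr : 1 + q ≠ 0 := by positivity
  simp only [potential, amplitudeParam, abs_mul, abs_of_pos hA,
    Real.mul_rpow hA.le (abs_nonneg s), h]
  field_simp
  ring

/-- For every amplitude `A` with positive energy there is an oscillation around `0` that fills the
whole level set of the energy. -/
theorem exists_signChanging_solution (hq0 : 0 < q) (hq1 : q < 1) {A : ℝ} (hA : 0 < A)
    (hc1 : amplitudeParam q A < 1) :
    ∃ w : ℝ → ℝ, IsODESolution 1 1 q w ∧ IsSignChanging w ∧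
      (∀ x y, energy q x y = potential q A → ∃ t, w t = x ∧ deriv w t = y) ∧
      (∀ t, w t ≠ 0 ∨ deriv w t ≠ 0) ∧
      Function.Periodic w (4 * signQuarterPeriod q (amplitudeParam q A)) ∧
      ∀ S, 0 < S → Function.Periodic w S →
        ∃ n : ℕ, 1 ≤ n ∧ S = n * (4 * signQuarterPeriod q (amplitudeParam q A)) := by
  set c := amplitudeParam q A with hc
  have hc0 : 0 < c := by rw [hc, amplitudeParam]; positivity
  have hpos := signSpeed_pos hq0 hq1 hc0.le hc1
  have hspos : ∀ x, 0 < √(signSpeed q c x) := fun x => Real.sqrt_pos.2 (hpos x)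
  -- Energy conservation gives the velocity A cos x √speed on w = A sin x, and w' = A cos x · x'
  -- then forces x' = √speed.
  obtain ⟨w, hw, horb, horb', hper, hmult⟩ := exists_solution_of_parametrization hq0
    (g := fun x => (√(signSpeed q c x))⁻¹) (Φ := fun x => A * Real.sin x)
    (Ψ := fun x => A * (Real.cos x * √(signSpeed q c x)))
    ((continuous_signSpeed hq0 c).sqrt.inv₀ fun x => (hspos x).ne')
    (fun x => inv_pos.2 (hspos x)) (fun x => by simp [signSpeed])
    (fun x => ((Real.hasDerivAt_sin x).const_mul A).congr_deriv (by
      have := (hspos x).ne'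
      field_simp))
    (fun x => ((hasDerivAt_cos_mul_sqrt_signSpeed hq0 hq1 hc0.le hc1 x).const_mul A).congr_deriv
      (by
        have hr : 1 + q ≠ 0 := by positivity
        have : (1 + q) / 2 * c = A ^ (q - 1) := by
          rw [hc, amplitudeParam]
          field_simp
        simp only [force]
        rw [this, abs_mul, abs_of_pos hA, Real.mul_rpow hA.le (abs_nonneg _)]
        ring))
    (fun x => by simp) (fun x hx => by
      have h1 : Real.sin x = 1 := by
        have := mul_left_cancel₀ hA.ne' hx
        rwa [Real.sin_pi_div_two] at this
      obtain ⟨n, hn⟩ := Real.sin_eq_one_iff.1 h1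
      exact ⟨n, hn.symm⟩)
  rw [integral_inv_sqrt_signSpeed hq0 hq1 hc0.le hc1] at hper hmult
  refine ⟨w, hw, ⟨?_, ?_⟩, ?_, ?_, hper, hmult⟩
  · obtain ⟨t, ht, -⟩ := horb (Real.pi / 2)
    exact ⟨t, by rw [ht]; simpa using hA⟩
  · obtain ⟨t, ht, -⟩ := horb (-(Real.pi / 2))
    exact ⟨t, by rw [ht]; simpa using hA⟩
  · intro x y hxy
    have hx : x = A * (x / A) := by field_simp
    have hE := potential_amplitude_sub hq0 hA (x / A)
    rw [← hx, ← hc] at hE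
    set s := x / A
    have hy : y ^ 2 = A ^ 2 * ((1 - s ^ 2) - c * (1 - |s| ^ (1 + q))) := by
      rw [energy] at hxy
      linarith
    -- Beyond the amplitude the energy relation would make y² negative, since 1 < |s|^(1+q) ≤ s² and
    -- c < 1.
    have hs : |s| ≤ 1 := by
      by_contra! hs
      have h1 : 1 < |s| ^ (1 + q) := Real.one_lt_rpow hs (by linarith)
      have h2 : |s| ^ (1 + q) ≤ s ^ 2 := by
        rw [← sq_abs, ← Real.rpow_natCast]
        exact Real.rpow_le_rpow_of_exponent_le hs.le (by push_cast; linarith)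
      have h3 : (1 - s ^ 2) - c * (1 - |s| ^ (1 + q)) < 0 := by nlinarith
      have h4 : 0 < A ^ 2 := by positivity
      nlinarith [sq_nonneg y]
    obtain ⟨hs1, hs2⟩ := abs_le.1 hs
    have hsin := Real.sin_arcsin hs1 hs2
    set x₀ := Real.arcsin s
    have hy2 : y ^ 2 = (A * (Real.cos x₀ * √(signSpeed q c x₀))) ^ 2 := by
      rw [hy, mul_pow, mul_pow, Real.sq_sqrt (hpos x₀).le, cos_sq_mul_signSpeed, hsin,
        Real.cos_sq', hsin]
    -- The angles x₀ and π - x₀ have the same position and opposite velocities.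
    rcases sq_eq_sq_iff_eq_or_eq_neg.1 hy2 with h | h
    · obtain ⟨t, ht1, ht2⟩ := horb x₀
      exact ⟨t, by rw [ht1, hsin, ← hx], by rw [ht2, h]⟩
    · obtain ⟨t, ht1, ht2⟩ := horb (Real.pi - x₀)
      refine ⟨t, by rw [ht1, Real.sin_pi_sub, hsin, ← hx], ?_⟩
      rw [ht2, h, Real.cos_pi_sub, signSpeed, signSpeed, Real.sin_pi_sub]
      ring
  · intro t
    obtain ⟨x, hx1, hx2⟩ := horb' t
    rw [hx1, hx2]
    by_contra! h
    have hs : Real.sin x = 0 := (mul_eq_zero.1 h.1).resolve_left hA.ne'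
    have hcos : Real.cos x = 0 :=
      (mul_eq_zero.1 ((mul_eq_zero.1 h.2).resolve_left hA.ne')).resolve_right (hspos x).ne'
    have := Real.sin_sq_add_cos_sq x
    rw [hs, hcos] at this
    norm_num at this

/-! ### The inequality for the period of positive solutions -/

lemma lt_of_hasDerivAt_pos_right {h h' : ℝ → ℝ} (hd : ∀ x, 0 < x → HasDerivAt h (h' x) x)
    (hp : ∀ x, 1 < x → 0 < h' x) {x : ℝ} (hx : 1 < x) : h 1 < h x := by
  refine strictMonoOn_of_deriv_pos (convex_Ici 1) (fun y hy =>
    (hd y (zero_lt_one.trans_le hy)).continuousAt.continuousWithinAt) (fun y hy => ?_)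
    self_mem_Ici hx.le hx
  rw [interior_Ici] at hy
  rw [(hd y (zero_lt_one.trans hy)).deriv]
  exact hp y hy

lemma lt_of_hasDerivAt_pos_left {h h' : ℝ → ℝ} (hd : ∀ x, 0 < x → HasDerivAt h (h' x) x)
    (hp : ∀ x, 0 < x → x < 1 → 0 < h' x) {x : ℝ} (hx0 : 0 < x) (hx : x < 1) : h x < h 1 := by
  refine strictMonoOn_of_deriv_pos (convex_Icc x 1) (fun y hy =>
    (hd y (hx0.trans_le hy.1)).continuousAt.continuousWithinAt) (fun y hy => ?_)
    ⟨le_rfl, hx.le⟩ ⟨hx.le, le_rfl⟩ hx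
  rw [interior_Icc] at hy
  rw [(hd y (hx0.trans hy.1)).deriv]
  exact hp y (hx0.trans hy.1) hy.2

/-- The cubic Taylor polynomial of `(1 - d)^(-n)` is a lower bound. -/
lemma one_sub_rpow_mul_taylor_le_one {n d : ℝ} (hn : 0 ≤ n) (hd0 : 0 ≤ d) (hd1 : d < 1) :
    (1 - d) ^ n * (1 + n * d + n * (n + 1) / 2 * d ^ 2 + n * (n + 1) * (n + 2) / 6 * d ^ 3) ≤ 1 := by
  let F : ℝ → ℝ := fun d => (1 - d) ^ n *
    (1 + n * d + n * (n + 1) / 2 * d ^ 2 + n * (n + 1) * (n + 2) / 6 * d ^ 3)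
  -- In (1-x)T' - nT, with T the Taylor polynomial, consecutive coefficients cancel and only the x³
  -- term is left.
  have hder : ∀ x, x < 1 → HasDerivAt F
      (-((1 - x) ^ (n - 1) * (n * (n + 1) * (n + 2) * (n + 3) / 6 * x ^ 3))) x := by
    intro x hx
    have hx' : 0 < 1 - x := by linarith
    have h1 := ((hasDerivAt_id x).const_sub 1).rpow_const (p := n) (Or.inl hx'.ne')
    have h2 := ((((hasDerivAt_id x).const_mul n).const_add 1).add
      (((hasDerivAt_id x).pow 2).const_mul (n * (n + 1) / 2))).add
      (((hasDerivAt_id x).pow 3).const_mul (n * (n + 1) * (n + 2) / 6))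
    refine (h1.mul h2).congr_deriv ?_
    have e : (1 - x) ^ n = (1 - x) ^ (n - 1) * (1 - x) := by
      rw [Real.rpow_sub_one hx'.ne']
      field_simp
    simp only [id, Pi.add_apply, Pi.pow_apply]
    rw [e]
    simp
    ring
  have hanti : AntitoneOn F (Icc 0 d) := by
    refine antitoneOn_of_deriv_nonpos (convex_Icc 0 d) (fun y hy =>
      (hder y (hy.2.trans_lt hd1)).continuousAt.continuousWithinAt) (fun y hy => ?_)
      (fun y hy => ?_) <;> rw [interior_Icc] at hy
    · exact (hder y (hy.2.trans hd1)).differentiableAt.differentiableWithinAt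
    · rw [(hder y (hy.2.trans hd1)).deriv, neg_nonpos]
      have := Real.rpow_nonneg (by linarith [hy.2] : (0 : ℝ) ≤ 1 - y) (n - 1)
      have := hy.1
      positivity
  have := hanti ⟨le_rfl, hd0⟩ ⟨hd0, le_rfl⟩ hd0
  simpa [F] using this

/-- The quadratic in d left over when the cubic Taylor bound is inserted in `periodAux_lt`. -/
lemma taylor_bracket_pos (hq0 : 0 < q) (hq1 : q < 1) {d : ℝ} (hd0 : 0 < d) (hd1 : d < 1) :
    0 < 3 * (6 + 2 * q) * (1 - q) ^ 2 - 6 * (2 - q) * (1 - q) * d + q * (2 - q) * d ^ 2 := by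
  obtain ⟨e, rfl⟩ : ∃ e, q = 1 - e := ⟨1 - q, by ring⟩
  have he0 : 0 < e := by linarith
  have he1 : e < 1 := by linarith
  -- With e = 1 - q the form is 6(4-e)e² - 6(1+e)ed + (1-e²)d². For e ≤ 2/5, complete the square
  -- after multiplying by 1 - e²; the remainder is e²(1+e)(15-39e+6e²) > 0. For e > 2/5, (4-e)e >
  -- 1+e > (1+e)d makes the first two terms positive together.
  rcases le_or_gt e (2 / 5) with h | h
  · have h1 : 0 < (1 - e ^ 2) := by nlinarith
    have h2 : 0 < e ^ 2 * (1 + e) * (15 - 39 * e + 6 * e ^ 2) := by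
      have : 0 < 15 - 39 * e + 6 * e ^ 2 := by nlinarith [sq_nonneg (e - 2 / 5)]
      positivity
    refine pos_of_mul_pos_right (a := 1 - e ^ 2) ?_ h1.le
    nlinarith [sq_nonneg ((1 - e ^ 2) * d - 3 * (1 + e) * e)]
  · have h1 : 0 < 3 * e - 1 - e ^ 2 := by nlinarith
    have h2 : 0 < (1 - e ^ 2) * d ^ 2 := by
      have : 0 < 1 - e ^ 2 := by nlinarith
      positivity
    have h3 : 0 < e * ((4 - e) * e - (1 + e) * d) := by
      refine mul_pos he0 ?_
      nlinarith
    nlinarith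

/-- The auxiliary function that governs the monotonicity of the period of positive solutions. -/
noncomputable def periodAux (q x : ℝ) : ℝ :=
  (4 - q) * (x ^ 2 / x ^ q) - (2 + 4 * q) * x + q * (1 + 2 * q) * x ^ q

lemma periodAux_eq {x : ℝ} (hx : 0 < x) :
    periodAux q x = x ^ q * (2 * (1 - q) ^ 2 - 6 * (1 - q) * (1 - x / x ^ q)
      + (4 - q) * (1 - x / x ^ q) ^ 2) := by
  have : 0 < x ^ q := Real.rpow_pos_of_pos hx q
  rw [periodAux]
  field_simp
  ring

lemma div_rpow_eq {x : ℝ} (hx : 0 < x) : x / x ^ q = x ^ (1 - q) := by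
  rw [Real.rpow_sub hx, Real.rpow_one]

/-- In the form of `periodAux_eq`, d = 1 - x^(1-q) is negative here, so the bracket exceeds 2(1-q)²,
and the factor x^q exceeds 1. -/
lemma lt_periodAux (hq0 : 0 < q) (hq1 : q < 1) {x : ℝ} (hx : 1 < x) :
    2 * (1 - q) ^ 2 < periodAux q x := by
  rw [periodAux_eq (by linarith), div_rpow_eq (by linarith)]
  have ha : 1 < x ^ q := Real.one_lt_rpow hx hq0
  have hz : 1 < x ^ (1 - q) := Real.one_lt_rpow hx (by linarith)
  have h1 : 2 * (1 - q) ^ 2 < 2 * (1 - q) ^ 2 - 6 * (1 - q) * (1 - x ^ (1 - q))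
      + (4 - q) * (1 - x ^ (1 - q)) ^ 2 := by
    have : 0 < (1 - q) * (x ^ (1 - q) - 1) := mul_pos (by linarith) (by linarith)
    have : 0 ≤ (4 - q) * (1 - x ^ (1 - q)) ^ 2 := mul_nonneg (by linarith) (sq_nonneg _)
    linarith
  have h2 : 0 < 2 * (1 - q) ^ 2 := by
    have : 0 < 1 - q := by linarith
    positivity
  nlinarith

/-- Now the factor x^q is below 1 but the bracket need not be below 2(1-q)². With d = 1 - x^(1-q)
one has x^q = (1-d)^n, n = q/(1-q), and the cubic Taylor bound for (1-d)^(-n) decides. -/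
lemma periodAux_lt (hq0 : 0 < q) (hq1 : q < 1) {x : ℝ} (hx0 : 0 < x) (hx : x < 1) :
    periodAux q x < 2 * (1 - q) ^ 2 := by
  have hδ : 0 < 1 - q := by linarith
  rw [periodAux_eq hx0, div_rpow_eq hx0]
  have hz0 : 0 < x ^ (1 - q) := Real.rpow_pos_of_pos hx0 _
  have hz1 : x ^ (1 - q) < 1 := Real.rpow_lt_one hx0.le hx hδ
  obtain ⟨d, hd⟩ : ∃ d, d = 1 - x ^ (1 - q) := ⟨_, rfl⟩
  have ha : x ^ q = (1 - d) ^ (q / (1 - q)) := by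
    rw [hd, sub_sub_cancel, ← Real.rpow_mul hx0.le]
    congr 1
    field_simp
  rw [← hd]
  have hT := one_sub_rpow_mul_taylor_le_one (n := q / (1 - q)) (d := d) (by positivity)
    (by linarith) (by linarith)
  rw [← ha] at hT
  have hapos : 0 < x ^ q := Real.rpow_pos_of_pos hx0 _
  generalize x ^ q = a at *
  have hbr := taylor_bracket_pos hq0 hq1 (d := d) (by linarith) (by linarith)
  have hR : 2 * (1 - q) ^ 2 * (1 + q / (1 - q) * d + q / (1 - q) * (q / (1 - q) + 1) / 2 * d ^ 2
      + q / (1 - q) * (q / (1 - q) + 1) * (q / (1 - q) + 2) / 6 * d ^ 3)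
      - (2 * (1 - q) ^ 2 - 6 * (1 - q) * d + (4 - q) * d ^ 2)
      = d * (3 * (6 + 2 * q) * (1 - q) ^ 2 - 6 * (2 - q) * (1 - q) * d + q * (2 - q) * d ^ 2)
        / (3 * (1 - q)) := by
    field_simp
    ring
  have hRpos : 0 < d * (3 * (6 + 2 * q) * (1 - q) ^ 2 - 6 * (2 - q) * (1 - q) * d
      + q * (2 - q) * d ^ 2) / (3 * (1 - q)) := by
    have : 0 < d := by linarith
    positivity
  rw [← hR] at hRpos
  have h1 := mul_pos hapos hRpos
  have h2 := mul_le_mul_of_nonneg_left hT (by positivity : (0 : ℝ) ≤ 2 * (1 - q) ^ 2)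
  nlinarith

/-- The excess `x² / 2 - x^(1+q) / (1+q) - min` of the potential, in terms of `x^q`. -/
noncomputable def excess (q x : ℝ) : ℝ :=
  x ^ 2 / 2 - x * x ^ q / (1 + q) - (1 / 2 - 1 / (1 + q))

lemma hasDerivAt_rpow_q {x : ℝ} (hx : 0 < x) :
    HasDerivAt (fun x : ℝ => x ^ q) (q * x ^ q / x) x := by
  refine (Real.hasDerivAt_rpow_const (Or.inl hx.ne')).congr_deriv ?_
  rw [Real.rpow_sub_one hx.ne']
  ring

lemma hasDerivAt_excess (hq0 : 0 < q) {x : ℝ} (hx : 0 < x) :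
    HasDerivAt (excess q) (x - x ^ q) x := by
  have h := ((((hasDerivAt_id x).pow 2).div_const 2).sub
    (((hasDerivAt_id x).mul (hasDerivAt_rpow_q (q := q) hx)).div_const (1 + q))).sub_const
      (1 / 2 - 1 / (1 + q))
  refine h.congr_deriv ?_
  simp only [id, Nat.cast_ofNat]
  field_simp
  ring

lemma excess_one : excess q 1 = 0 := by
  simp [excess]

lemma rpow_lt_self_of_one_lt (hq1 : q < 1) {x : ℝ} (hx : 1 < x) : x ^ q < x := by
  simpa using Real.rpow_lt_rpow_of_exponent_lt hx hq1

lemma self_lt_rpow_of_lt_one (hq1 : q < 1) {x : ℝ} (hx0 : 0 < x) (hx : x < 1) : x < x ^ q := by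
  simpa using Real.rpow_lt_rpow_of_exponent_gt hx0 hx hq1

/-- The inequality behind the monotonicity of the period of positive solutions. -/
theorem period_inequality (hq0 : 0 < q) (hq1 : q < 1) {x : ℝ} (hx0 : 0 < x) (hx1 : x ≠ 1) :
    0 < (x - x ^ q) ^ 2 - 2 * excess q x * (1 - q * x ^ q / x)
      + q / (3 * (1 - q)) * (x - x ^ q) ^ 3 := by
  have hδ : 0 < 1 - q := by linarith
  have hsgn : ∀ x : ℝ, 1 < x → 0 < x - x ^ q := fun x hx => by
    linarith [rpow_lt_self_of_one_lt hq1 hx]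
  have hsgn' : ∀ x : ℝ, 0 < x → x < 1 → x - x ^ q < 0 := fun x h0 hx => by
    linarith [self_lt_rpow_of_lt_one hq1 h0 hx]
  -- What remains of the derivative of the left-hand side after removing the positive factor q x^q /
  -- x². It vanishes at 1 and increases: in its derivative, x - x^q and `periodAux` - 2(1-q)² change
  -- sign together at 1.
  let f₁ : ℝ → ℝ := fun x => -2 * (1 - q) * excess q x
    + (x ^ 4 / x ^ q - (2 + q) * x ^ 3 + (1 + 2 * q) * (x ^ 2 * x ^ q) - q * (x * (x ^ q) ^ 2))
      / (1 - q)
  have hf₁ : ∀ x, 0 < x → HasDerivAt f₁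
      ((x - x ^ q) * (periodAux q x - 2 * (1 - q) ^ 2) / (1 - q)) x := fun x hx => by
    have ha := hasDerivAt_rpow_q (q := q) hx
    have hapos : 0 < x ^ q := Real.rpow_pos_of_pos hx q
    have hid := hasDerivAt_id x
    have h := ((hasDerivAt_excess hq0 hx).const_mul (-2 * (1 - q))).add
      ((((((hid.pow 4).div ha hapos.ne').sub ((hid.pow 3).const_mul (2 + q))).add
        (((hid.pow 2).mul ha).const_mul (1 + 2 * q))).sub
        ((hid.mul (ha.pow 2)).const_mul q)).div_const (1 - q))
    refine h.congr_deriv ?_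
    simp only [id, Pi.pow_apply, periodAux]
    field_simp
    norm_num
    ring
  have hf₁1 : f₁ 1 = 0 := by
    simp only [f₁, excess_one, Real.one_rpow]
    ring
  have hf₁r : ∀ x, 1 < x → 0 < f₁ x := fun x hx => by
    rw [← hf₁1]
    refine lt_of_hasDerivAt_pos_right hf₁ (fun y hy => ?_) hx
    exact div_pos (mul_pos (hsgn y hy) (by linarith [lt_periodAux hq0 hq1 hy])) hδ
  have hf₁l : ∀ x, 0 < x → x < 1 → f₁ x < 0 := fun x hx0 hx => by
    rw [← hf₁1]
    refine lt_of_hasDerivAt_pos_left hf₁ (fun y hy0 hy => ?_) hx0 hx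
    exact div_pos (mul_pos_of_neg_of_neg (hsgn' y hy0 hy)
      (by linarith [periodAux_lt hq0 hq1 hy0 hy])) hδ
  -- The expression to be bounded: f₀(1) = 0, and f₀' has the sign of f₁, hence of x - 1, so 1 is
  -- the strict minimum.
  let f₀ : ℝ → ℝ := fun x => (x - x ^ q) ^ 2 - 2 * excess q x * (1 - q * x ^ q / x)
      + q / (3 * (1 - q)) * (x - x ^ q) ^ 3
  have hf₀ : ∀ x, 0 < x → HasDerivAt f₀ (q * x ^ q / x ^ 2 * f₁ x) x := fun x hx => by
    have ha := hasDerivAt_rpow_q (q := q) hx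
    have hapos : 0 < x ^ q := Real.rpow_pos_of_pos hx q
    have hid := hasDerivAt_id x
    have hU := hid.sub ha
    have h := ((hU.pow 2).sub (((hasDerivAt_excess hq0 hx).const_mul 2).mul
      (((ha.const_mul q).div hid hx.ne').const_sub 1))).add
      ((hU.pow 3).const_mul (q / (3 * (1 - q))))
    refine h.congr_deriv ?_
    simp only [id, Pi.sub_apply, Pi.div_apply, f₁]
    generalize excess q x = E
    field_simp
    norm_num
    ring
  have hf₀1 : f₀ 1 = 0 := by
    simp only [f₀, excess_one, Real.one_rpow]
    ring
  have hcoef : ∀ x : ℝ, 0 < x → 0 < q * x ^ q / x ^ 2 := fun x hx => by positivity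
  change 0 < f₀ x
  rcases hx1.lt_or_gt with hx | hx
  · have := lt_of_hasDerivAt_pos_left (fun y hy => (hf₀ y hy).neg) (fun y hy0 hy => by
      have := mul_pos_of_neg_of_neg (neg_neg_of_pos (hcoef y hy0)) (hf₁l y hy0 hy)
      linarith) hx0 hx
    simp only [Pi.neg_apply] at this
    linarith
  · rw [← hf₀1]
    exact lt_of_hasDerivAt_pos_right hf₀
      (fun y hy => mul_pos (hcoef y (by linarith)) (hf₁r y hy)) hx

/-! ### The coordinate that makes the potential well a parabola -/

lemma force_of_pos {x : ℝ} (hx : 0 < x) : force q x = x ^ q - x := by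
  rw [force, abs_of_pos hx, Real.rpow_sub_one hx.ne']
  field_simp

lemma hasDerivAt_force {x : ℝ} (hx : 0 < x) : HasDerivAt (force q) (q * x ^ q / x - 1) x :=
  ((hasDerivAt_rpow_q hx).sub (hasDerivAt_id x)).congr_of_eventuallyEq (by
    filter_upwards [lt_mem_nhds hx] with y hy using force_of_pos hy)

lemma excess_eq (hq0 : 0 < q) {x : ℝ} (hx : 0 ≤ x) :
    excess q x = potential q x - potential q 1 := by
  have h : x ^ (1 + q) = x * x ^ q := by
    rcases hx.eq_or_lt with rfl | h
    · simp [Real.zero_rpow (by linarith : 1 + q ≠ 0)]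
    · rw [Real.rpow_add h, Real.rpow_one]
  simp [excess, potential, abs_of_nonneg hx, h]

lemma continuous_excess (hq0 : 0 < q) : Continuous (excess q) := by
  unfold excess
  have := Real.continuous_rpow_const hq0.le
  fun_prop

lemma excess_strictMonoOn (hq0 : 0 < q) (hq1 : q < 1) : StrictMonoOn (excess q) (Ici 1) := by
  refine strictMonoOn_of_deriv_pos (convex_Ici 1) (continuous_excess hq0).continuousOn fun y hy => ?_
  rw [interior_Ici] at hy
  rw [(hasDerivAt_excess hq0 (zero_lt_one.trans hy)).deriv]
  linarith [rpow_lt_self_of_one_lt hq1 hy]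

lemma excess_strictAntiOn (hq0 : 0 < q) (hq1 : q < 1) : StrictAntiOn (excess q) (Icc 0 1) := by
  refine strictAntiOn_of_deriv_neg (convex_Icc 0 1) (continuous_excess hq0).continuousOn
    fun y hy => ?_
  rw [interior_Icc] at hy
  rw [(hasDerivAt_excess hq0 hy.1).deriv]
  linarith [self_lt_rpow_of_lt_one hq1 hy.1 hy.2]

lemma excess_pos (hq0 : 0 < q) (hq1 : q < 1) {x : ℝ} (hx0 : 0 ≤ x) (hx1 : x ≠ 1) :
    0 < excess q x := by
  rw [← excess_one (q := q)]
  rcases hx1.lt_or_gt with h | h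
  · exact excess_strictAntiOn hq0 hq1 ⟨hx0, h.le⟩ ⟨zero_le_one, le_rfl⟩ h
  · exact excess_strictMonoOn hq0 hq1 self_mem_Ici h.le h

lemma excess_nonneg (hq0 : 0 < q) (hq1 : q < 1) {x : ℝ} (hx0 : 0 ≤ x) : 0 ≤ excess q x := by
  by_cases h : x = 1
  · rw [h, excess_one]
  · exact (excess_pos hq0 hq1 hx0 h).le

lemma tendsto_potential_atTop (hq1 : q < 1) :
    Tendsto (potential q) atTop atTop := by
  have h1 : Tendsto (fun x : ℝ => x ^ (q - 1)) atTop (𝓝 0) := by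
    simpa using tendsto_rpow_neg_atTop (by linarith : 0 < 1 - q)
  have h2 : Tendsto (fun x : ℝ => 1 / 2 - x ^ (q - 1) / (1 + q)) atTop (𝓝 (1 / 2)) := by
    have := (h1.div_const (1 + q)).const_sub (1 / 2)
    rwa [zero_div, sub_zero] at this
  have h3 := (tendsto_pow_atTop (two_ne_zero)).atTop_mul_pos (by norm_num : (0 : ℝ) < 1 / 2) h2
  refine h3.congr' ?_
  filter_upwards [eventually_gt_atTop 0] with x hx
  rw [potential, abs_of_pos hx, show 1 + q = 2 + (q - 1) by ring, Real.rpow_add hx,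
    show x ^ (2 : ℝ) = x ^ 2 by norm_cast]
  ring

/-- The signed square root of twice the excess, which turns the potential well into a parabola. -/
noncomputable def rootCoord (q x : ℝ) : ℝ :=
  if x ≤ 1 then -√(2 * excess q x) else √(2 * excess q x)

lemma rootCoord_of_le {x : ℝ} (hx : x ≤ 1) : rootCoord q x = -√(2 * excess q x) := if_pos hx

lemma rootCoord_of_ge {x : ℝ} (hx : 1 ≤ x) : rootCoord q x = √(2 * excess q x) := by
  rcases hx.eq_or_lt with rfl | h
  · simp [rootCoord, excess_one]
  · exact if_neg h.not_ge

lemma continuous_rootCoord (hq0 : 0 < q) : Continuous (rootCoord q) := by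
  have h : Continuous fun x => √(2 * excess q x) := (continuous_const.mul (continuous_excess hq0)).sqrt
  refine Continuous.if_le h.neg h continuous_id continuous_const fun x hx => ?_
  have hx : x = 1 := hx
  simp [hx, excess_one]

lemma rootCoord_sq (hq0 : 0 < q) (hq1 : q < 1) {x : ℝ} (hx : 0 ≤ x) :
    rootCoord q x ^ 2 = 2 * excess q x := by
  have := excess_nonneg hq0 hq1 hx
  rw [rootCoord]
  split_ifs
  · rw [neg_sq, Real.sq_sqrt (by positivity)]
  · rw [Real.sq_sqrt (by positivity)]

lemma strictMonoOn_rootCoord (hq0 : 0 < q) (hq1 : q < 1) : StrictMonoOn (rootCoord q) (Ici 0) := by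
  have h1 : StrictMonoOn (rootCoord q) (Icc 0 1) := fun x hx y hy hxy => by
    rw [rootCoord_of_le hx.2, rootCoord_of_le hy.2, neg_lt_neg_iff]
    have h := excess_strictAntiOn hq0 hq1 hx hy hxy
    exact Real.sqrt_lt_sqrt (by linarith [excess_nonneg hq0 hq1 hy.1]) (by linarith)
  have h2 : StrictMonoOn (rootCoord q) (Ici 1) := fun x hx y hy hxy => by
    rw [rootCoord_of_ge hx, rootCoord_of_ge hy]
    have h := excess_strictMonoOn hq0 hq1 hx hy hxy
    have h0 := excess_nonneg hq0 hq1 (zero_le_one.trans hx : (0 : ℝ) ≤ x)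
    exact Real.sqrt_lt_sqrt (by linarith) (by linarith)
  have h := h1.union h2 (c := 1) ⟨⟨zero_le_one, le_rfl⟩, fun x hx => hx.2⟩
    ⟨self_mem_Ici, fun x hx => hx⟩
  rwa [Icc_union_Ici_eq_Ici zero_le_one] at h

/-- `rootCoord`, extended to the negative half-line as an increasing bijection. -/
noncomputable def wellCoord (q x : ℝ) : ℝ := min x 0 + rootCoord q (max x 0)

lemma wellCoord_of_nonneg {x : ℝ} (hx : 0 ≤ x) : wellCoord q x = rootCoord q x := by
  simp [wellCoord, hx]

lemma continuous_wellCoord (hq0 : 0 < q) : Continuous (wellCoord q) :=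
  (continuous_id.min continuous_const).add
    ((continuous_rootCoord hq0).comp (continuous_id.max continuous_const))

lemma strictMono_wellCoord (hq0 : 0 < q) (hq1 : q < 1) : StrictMono (wellCoord q) := by
  intro x y hxy
  have hm := strictMonoOn_rootCoord hq0 hq1
  rcases lt_or_ge x 0 with hx | hx
  · have h1 : min x 0 < min y 0 := by
      rw [min_eq_left hx.le]
      exact lt_min hxy hx
    have h2 : rootCoord q (max x 0) ≤ rootCoord q (max y 0) :=
      hm.monotoneOn (le_max_right x 0) (le_max_right y 0) (max_le_max_right 0 hxy.le)
    simp only [wellCoord]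
    linarith
  · rw [wellCoord_of_nonneg hx, wellCoord_of_nonneg (hx.trans hxy.le)]
    exact hm hx (hx.trans hxy.le) hxy

lemma surjective_wellCoord (hq0 : 0 < q) (hq1 : q < 1) : Function.Surjective (wellCoord q) := by
  refine (continuous_wellCoord hq0).surjective ?_ ?_
  · have h : Tendsto (fun x => √(2 * (potential q x + (-potential q 1)))) atTop atTop :=
      Real.tendsto_sqrt_atTop.comp ((tendsto_atTop_add_const_right _ _
        (tendsto_potential_atTop hq1)).const_mul_atTop two_pos)
    refine h.congr' ?_
    filter_upwards [eventually_ge_atTop 1] with x hx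
    have hx0 : 0 ≤ x := zero_le_one.trans hx
    rw [wellCoord_of_nonneg hx0, rootCoord_of_ge hx, excess_eq hq0 hx0, sub_eq_add_neg]
  · have h : Tendsto (fun x => x + rootCoord q 0) atBot atBot :=
      tendsto_atBot_add_const_right _ _ tendsto_id
    refine h.congr' ?_
    filter_upwards [eventually_le_atBot 0] with x hx
    simp [wellCoord, hx]

/-- The derivative of `wellCoord` on the positive half-line. -/
noncomputable def wellCoordDeriv (q x : ℝ) : ℝ :=
  if x = 1 then √(1 - q) else -force q x / wellCoord q x

lemma wellCoord_one : wellCoord q 1 = 0 := by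
  rw [wellCoord_of_nonneg zero_le_one, rootCoord_of_le le_rfl, excess_one]
  simp

lemma wellCoord_sq (hq0 : 0 < q) (hq1 : q < 1) {x : ℝ} (hx : 0 ≤ x) :
    wellCoord q x ^ 2 = 2 * excess q x := by
  rw [wellCoord_of_nonneg hx, rootCoord_sq hq0 hq1 hx]

lemma wellCoord_ne_zero (hq0 : 0 < q) (hq1 : q < 1) {x : ℝ} (hx1 : x ≠ 1) :
    wellCoord q x ≠ 0 := by
  rw [← wellCoord_one (q := q)]
  exact (strictMono_wellCoord hq0 hq1).injective.ne hx1

lemma hasDerivAt_wellCoord_of_ne (hq0 : 0 < q) (hq1 : q < 1) {x : ℝ} (hx0 : 0 < x)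
    (hx1 : x ≠ 1) : HasDerivAt (wellCoord q) (-force q x / wellCoord q x) x := by
  have hE := excess_pos hq0 hq1 hx0.le hx1
  have h := ((hasDerivAt_excess hq0 hx0).const_mul 2).sqrt (by positivity)
  rw [force_of_pos hx0]
  have hs : 0 < √(2 * excess q x) := by positivity
  rcases hx1.lt_or_gt with h1 | h1
  · have := h.neg.congr_of_eventuallyEq (f₁ := wellCoord q) (by
      filter_upwards [lt_mem_nhds hx0, gt_mem_nhds h1] with y hy0 hy1
      rw [wellCoord_of_nonneg hy0.le, rootCoord_of_le hy1.le]
      rfl)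
    refine this.congr_deriv ?_
    rw [wellCoord_of_nonneg hx0.le, rootCoord_of_le h1.le]
    field_simp
    ring
  · have := h.congr_of_eventuallyEq (f₁ := wellCoord q) (by
      filter_upwards [lt_mem_nhds hx0, lt_mem_nhds h1] with y hy0 hy1
      rw [wellCoord_of_nonneg hy0.le, rootCoord_of_ge hy1.le])
    refine this.congr_deriv ?_
    rw [wellCoord_of_nonneg hx0.le, rootCoord_of_ge h1.le]
    field_simp
    ring

lemma force_one : force q 1 = 0 := by simp [force]

lemma tendsto_neg_force_div (q : ℝ) :
    Tendsto (fun x => -force q x / (x - 1)) (𝓝[≠] 1) (𝓝 (1 - q)) := by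
  have h := (hasDerivAt_force (q := q) one_pos).fun_neg
  rw [hasDerivAt_iff_tendsto_slope] at h
  simp only [Real.one_rpow] at h
  convert h using 2 with x
  · rw [slope_def_field, force_one]
    simp
  · ring

/-- Numerator and denominator vanish to second order at 1; l'Hôpital leaves the difference quotient
of the force. -/
lemma tendsto_excess_div (hq0 : 0 < q) :
    Tendsto (fun x => 2 * excess q x / (x - 1) ^ 2) (𝓝[≠] 1) (𝓝 (1 - q)) := by
  have hpos : ∀ᶠ x : ℝ in 𝓝[≠] 1, 0 < x :=
    (lt_mem_nhds one_pos).filter_mono nhdsWithin_le_nhds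
  refine HasDerivAt.lhopital_zero_nhdsNE (f' := fun x => 2 * (x - x ^ q))
    (g' := fun x => 2 * (x - 1)) ?_ ?_ ?_ ?_ ?_ ?_
  · filter_upwards [hpos] with x hx using (hasDerivAt_excess hq0 hx).const_mul 2
  · refine Eventually.of_forall fun x => ?_
    simpa using ((hasDerivAt_id x).sub_const 1).fun_pow 2
  · filter_upwards [self_mem_nhdsWithin] with x hx
    have : x - 1 ≠ 0 := sub_ne_zero.2 hx
    positivity
  · have := ((continuous_const.mul (continuous_excess hq0)).tendsto' (1 : ℝ) (0 : ℝ)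
      (by simp [excess_one]) : Tendsto (fun x => 2 * excess q x) _ _)
    exact this.mono_left nhdsWithin_le_nhds
  · have : Tendsto (fun x : ℝ => (x - 1) ^ 2) (𝓝 1) (𝓝 0) :=
      Continuous.tendsto' (by fun_prop) _ _ (by simp)
    exact this.mono_left nhdsWithin_le_nhds
  · refine (tendsto_neg_force_div q).congr' ?_
    filter_upwards [hpos] with x hx
    rw [force_of_pos hx, mul_div_mul_left _ _ two_ne_zero, neg_sub]

lemma tendsto_wellCoord_div (hq0 : 0 < q) :
    Tendsto (fun x => wellCoord q x / (x - 1)) (𝓝[≠] 1) (𝓝 (√(1 - q))) := by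
  have hpos : ∀ᶠ x : ℝ in 𝓝[≠] 1, 0 < x :=
    (lt_mem_nhds one_pos).filter_mono nhdsWithin_le_nhds
  refine (tendsto_excess_div hq0).sqrt.congr' ?_
  filter_upwards [hpos, self_mem_nhdsWithin] with x hx hx1
  have hx1 : x ≠ 1 := hx1
  rw [Real.sqrt_div' _ (sq_nonneg _), Real.sqrt_sq_eq_abs, wellCoord_of_nonneg hx.le]
  rcases hx1.lt_or_gt with h | h
  · rw [rootCoord_of_le h.le, abs_of_neg (by linarith), div_neg, neg_div]
  · rw [rootCoord_of_ge h.le, abs_of_pos (by linarith)]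

lemma hasDerivAt_wellCoord (hq0 : 0 < q) (hq1 : q < 1) {x : ℝ} (hx : 0 < x) :
    HasDerivAt (wellCoord q) (wellCoordDeriv q x) x := by
  by_cases h : x = 1
  · subst h
    rw [wellCoordDeriv, if_pos rfl, hasDerivAt_iff_tendsto_slope]
    refine (tendsto_wellCoord_div hq0).congr fun x => ?_
    rw [slope_def_field, wellCoord_one, sub_zero]
  · rw [wellCoordDeriv, if_neg h]
    exact hasDerivAt_wellCoord_of_ne hq0 hq1 hx h

lemma wellCoordDeriv_pos (hq0 : 0 < q) (hq1 : q < 1) {x : ℝ} (hx : 0 < x) :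
    0 < wellCoordDeriv q x := by
  rw [wellCoordDeriv]
  split_ifs with h
  · exact Real.sqrt_pos.2 (by linarith)
  · have hm := strictMono_wellCoord hq0 hq1
    rw [force_of_pos hx]
    rcases lt_or_gt_of_ne h with h1 | h1
    · have := hm h1
      rw [wellCoord_one] at this
      exact div_pos_of_neg_of_neg (by linarith [self_lt_rpow_of_lt_one hq1 hx h1]) this
    · have := hm h1
      rw [wellCoord_one] at this
      exact div_pos (by linarith [rpow_lt_self_of_one_lt hq1 h1]) this

/-- At the bottom of the well, force and coordinate both vanish to first order; dividing each by x -
1 gives the limit (1-q)/√(1-q) = √(1-q). -/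
lemma continuousAt_wellCoordDeriv (hq0 : 0 < q) (hq1 : q < 1) {x : ℝ} (hx : 0 < x) :
    ContinuousAt (wellCoordDeriv q) x := by
  by_cases h : x = 1
  · subst h
    rw [continuousAt_iff_punctured_nhds, wellCoordDeriv, if_pos rfl]
    have hδ : 0 < 1 - q := by linarith
    have h1 := (tendsto_neg_force_div q).div (tendsto_wellCoord_div hq0) (Real.sqrt_pos.2 hδ).ne'
    rw [Real.div_sqrt] at h1
    refine h1.congr' ?_
    filter_upwards [self_mem_nhdsWithin] with x hx1
    have hx1 : x ≠ 1 := hx1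
    rw [wellCoordDeriv, if_neg hx1, Pi.div_apply, div_div_div_cancel_right₀ (sub_ne_zero.2 hx1)]
  · have hc : ContinuousAt (fun x => -force q x / wellCoord q x) x :=
      (continuous_force hq0).neg.continuousAt.div (continuous_wellCoord hq0).continuousAt
        (wellCoord_ne_zero hq0 hq1 h)
    refine hc.congr ?_
    filter_upwards [isOpen_ne.mem_nhds h] with y hy
    rw [wellCoordDeriv, if_neg hy]

/-! ### The inverse coordinate and its derivatives -/

/-- The inverse of `wellCoord`. -/
noncomputable def wellInv (q : ℝ) : ℝ → ℝ := Function.invFun (wellCoord q)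

lemma wellInv_wellCoord (hq0 : 0 < q) (hq1 : q < 1) (x : ℝ) : wellInv q (wellCoord q x) = x :=
  Function.leftInverse_invFun (strictMono_wellCoord hq0 hq1).injective x

lemma wellCoord_wellInv (hq0 : 0 < q) (hq1 : q < 1) (y : ℝ) : wellCoord q (wellInv q y) = y :=
  Function.rightInverse_invFun (surjective_wellCoord hq0 hq1) y

lemma strictMono_wellInv (hq0 : 0 < q) (hq1 : q < 1) : StrictMono (wellInv q) := fun x y hxy => by
  rw [← (strictMono_wellCoord hq0 hq1).lt_iff_lt, wellCoord_wellInv hq0 hq1,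
    wellCoord_wellInv hq0 hq1]
  exact hxy

lemma continuous_wellInv (hq0 : 0 < q) (hq1 : q < 1) : Continuous (wellInv q) :=
  (strictMono_wellInv hq0 hq1).monotone.continuous_of_surjective
    fun x => ⟨wellCoord q x, wellInv_wellCoord hq0 hq1 x⟩

/-- The depth of the well, as a radius in the phase plane. -/
noncomputable def wellRadius (q : ℝ) : ℝ := √((1 - q) / (1 + q))

lemma wellRadius_pos (hq0 : 0 < q) (hq1 : q < 1) : 0 < wellRadius q :=
  Real.sqrt_pos.2 (div_pos (by linarith) (by linarith))

lemma wellRadius_sq (hq0 : 0 < q) (hq1 : q < 1) : wellRadius q ^ 2 = (1 - q) / (1 + q) :=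
  Real.sq_sqrt (div_nonneg (by linarith) (by linarith))

lemma wellCoord_zero (hq0 : 0 < q) : wellCoord q 0 = -wellRadius q := by
  rw [wellCoord_of_nonneg le_rfl, rootCoord_of_le zero_le_one, wellRadius]
  congr 2
  simp only [excess]
  field_simp
  ring

lemma wellInv_neg_wellRadius (hq0 : 0 < q) (hq1 : q < 1) : wellInv q (-wellRadius q) = 0 := by
  rw [← wellCoord_zero hq0, wellInv_wellCoord hq0 hq1]

lemma wellInv_zero (hq0 : 0 < q) (hq1 : q < 1) : wellInv q 0 = 1 := by
  rw [← wellCoord_one (q := q), wellInv_wellCoord hq0 hq1]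

lemma wellInv_pos (hq0 : 0 < q) (hq1 : q < 1) {y : ℝ} (hy : -wellRadius q < y) :
    0 < wellInv q y := by
  rw [← wellInv_neg_wellRadius hq0 hq1]
  exact strictMono_wellInv hq0 hq1 hy

lemma two_mul_excess_wellInv (hq0 : 0 < q) (hq1 : q < 1) {y : ℝ} (hy : -wellRadius q ≤ y) :
    2 * excess q (wellInv q y) = y ^ 2 := by
  have h : 0 ≤ wellInv q y := by
    rw [← wellInv_neg_wellRadius hq0 hq1]
    exact (strictMono_wellInv hq0 hq1).monotone hy
  rw [← wellCoord_sq hq0 hq1 h, wellCoord_wellInv hq0 hq1]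

/-- The derivative of `wellInv`. -/
noncomputable def wellInvDeriv (q y : ℝ) : ℝ := (wellCoordDeriv q (wellInv q y))⁻¹

lemma hasDerivAt_wellInv (hq0 : 0 < q) (hq1 : q < 1) {y : ℝ} (hy : -wellRadius q < y) :
    HasDerivAt (wellInv q) (wellInvDeriv q y) y :=
  HasDerivAt.of_local_left_inverse (continuous_wellInv hq0 hq1).continuousAt
    (hasDerivAt_wellCoord hq0 hq1 (wellInv_pos hq0 hq1 hy))
    (wellCoordDeriv_pos hq0 hq1 (wellInv_pos hq0 hq1 hy)).ne'
    (Eventually.of_forall (wellCoord_wellInv hq0 hq1))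

lemma wellInvDeriv_pos (hq0 : 0 < q) (hq1 : q < 1) {y : ℝ} (hy : -wellRadius q < y) :
    0 < wellInvDeriv q y :=
  inv_pos.2 (wellCoordDeriv_pos hq0 hq1 (wellInv_pos hq0 hq1 hy))

lemma continuousAt_wellInvDeriv (hq0 : 0 < q) (hq1 : q < 1) {y : ℝ} (hy : -wellRadius q < y) :
    ContinuousAt (wellInvDeriv q) y := by
  have hw := wellInv_pos hq0 hq1 hy
  exact ((continuousAt_wellCoordDeriv hq0 hq1 hw).comp
    (continuous_wellInv hq0 hq1).continuousAt).inv₀ (wellCoordDeriv_pos hq0 hq1 hw).ne'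

lemma wellInvDeriv_zero (hq0 : 0 < q) (hq1 : q < 1) : wellInvDeriv q 0 = (√(1 - q))⁻¹ := by
  rw [wellInvDeriv, wellInv_zero hq0 hq1, wellCoordDeriv, if_pos rfl]

lemma wellInv_ne_one (hq0 : 0 < q) (hq1 : q < 1) {y : ℝ} (hy : y ≠ 0) : wellInv q y ≠ 1 := by
  rw [← wellInv_zero hq0 hq1]
  exact (strictMono_wellInv hq0 hq1).injective.ne hy

lemma wellInvDeriv_of_ne (hq0 : 0 < q) (hq1 : q < 1) {y : ℝ} (hy : y ≠ 0) :
    wellInvDeriv q y = y / -force q (wellInv q y) := by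
  rw [wellInvDeriv, wellCoordDeriv, if_neg (wellInv_ne_one hq0 hq1 hy),
    wellCoord_wellInv hq0 hq1, inv_div]

/-- The derivative of 2 · excess(S(y)) = y², with S = `wellInv`. The product form also covers y = 0,
where the quotient is 0/0. -/
lemma force_mul_wellInvDeriv (hq0 : 0 < q) (hq1 : q < 1) {y : ℝ} (hy : -wellRadius q < y) :
    force q (wellInv q y) * wellInvDeriv q y = -y := by
  by_cases h : y = 0
  · rw [h, wellInv_zero hq0 hq1, force_one]
    simp
  · have := (wellInvDeriv_pos hq0 hq1 hy).ne'
    rw [wellInvDeriv_of_ne hq0 hq1 h] at this ⊢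
    have hf : force q (wellInv q y) ≠ 0 := fun h0 => this (by rw [h0]; simp)
    field_simp

/-- With U = x - x^q, the derivative of the excess, S' = y/U(S) gives S'' = (U² - y²U')/U³, and y²
is twice the excess. -/
lemma hasDerivAt_wellInvDeriv (hq0 : 0 < q) (hq1 : q < 1) {y : ℝ} (hy : -wellRadius q < y)
    (hy0 : y ≠ 0) :
    HasDerivAt (wellInvDeriv q)
      (((wellInv q y - wellInv q y ^ q) ^ 2 - 2 * excess q (wellInv q y)
        * (1 - q * wellInv q y ^ q / wellInv q y)) / (wellInv q y - wellInv q y ^ q) ^ 3) y := by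
  have hw := wellInv_pos hq0 hq1 hy
  have hf : force q (wellInv q y) ≠ 0 := by
    intro h0
    have := force_mul_wellInvDeriv hq0 hq1 hy
    rw [h0, zero_mul] at this
    exact hy0 (by linarith)
  have h1 := ((hasDerivAt_force (q := q) hw).comp y (hasDerivAt_wellInv hq0 hq1 hy)).neg
  have h2 := ((hasDerivAt_id y).div h1 (neg_ne_zero.2 hf)).congr_of_eventuallyEq
    (f₁ := wellInvDeriv q) (by
      filter_upwards [isOpen_ne.mem_nhds hy0] with z hz
      exact wellInvDeriv_of_ne hq0 hq1 hz)
  refine h2.congr_deriv ?_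
  rw [two_mul_excess_wellInv hq0 hq1 hy.le, wellInvDeriv_of_ne hq0 hq1 hy0]
  simp only [Function.comp_apply, Pi.neg_apply, id, force_of_pos hw] at *
  have hf' : wellInv q y - wellInv q y ^ q ≠ 0 := fun h => hf (by linarith)
  rw [show -(wellInv q y ^ q - wellInv q y) = wellInv q y - wellInv q y ^ q by ring]
  field_simp
  ring

/-- The derivative S''(y) - S''(-y) is positive because the limit -q/(3(1-q)) of S'' at 0 separates
the two terms. Both bounds are `period_inequality` divided by U³, which is positive to the right of
1 and negative to the left. -/
lemma wellInvDeriv_add_strictMonoOn (hq0 : 0 < q) (hq1 : q < 1) :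
    StrictMonoOn (fun y => wellInvDeriv q y + wellInvDeriv q (-y)) (Ico 0 (wellRadius q)) := by
  refine strictMonoOn_of_deriv_pos (convex_Ico _ _) (fun y hy => ?_) (fun y hy => ?_)
  · have h1 := continuousAt_wellInvDeriv hq0 hq1 (y := y) (by linarith [hy.1, wellRadius_pos hq0 hq1])
    have h2 := continuousAt_wellInvDeriv hq0 hq1 (y := -y) (by linarith [hy.2])
    exact (h1.add (h2.comp continuous_neg.continuousAt)).continuousWithinAt
  · rw [interior_Ico] at hy
    have hy1 : -wellRadius q < y := by linarith [hy.1, wellRadius_pos hq0 hq1]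
    have hy2 : -wellRadius q < -y := by linarith [hy.2]
    have h1 := hasDerivAt_wellInvDeriv hq0 hq1 hy1 hy.1.ne'
    have h2 := (hasDerivAt_wellInvDeriv hq0 hq1 hy2 (neg_ne_zero.2 hy.1.ne')).comp y
      (hasDerivAt_neg y)
    change 0 < deriv (wellInvDeriv q + wellInvDeriv q ∘ Neg.neg) y
    rw [(h1.add h2).deriv]
    have hm := strictMono_wellInv hq0 hq1
    have ha1 : 1 < wellInv q y := by rw [← wellInv_zero hq0 hq1]; exact hm hy.1
    have hb1 : wellInv q (-y) < 1 := by rw [← wellInv_zero hq0 hq1]; exact hm (by linarith [hy.1])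
    have hb0 := wellInv_pos hq0 hq1 hy2
    have hA := period_inequality hq0 hq1 (zero_lt_one.trans ha1) ha1.ne'
    have hB := period_inequality hq0 hq1 hb0 hb1.ne
    have hUa : 0 < wellInv q y - wellInv q y ^ q := by
      linarith [rpow_lt_self_of_one_lt hq1 ha1]
    have hUb : wellInv q (-y) - wellInv q (-y) ^ q < 0 := by
      linarith [self_lt_rpow_of_lt_one hq1 hb0 hb1]
    have h3 : -(q / (3 * (1 - q))) < ((wellInv q y - wellInv q y ^ q) ^ 2
        - 2 * excess q (wellInv q y) * (1 - q * wellInv q y ^ q / wellInv q y))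
          / (wellInv q y - wellInv q y ^ q) ^ 3 := by
      rw [lt_div_iff₀ (by positivity)]
      linarith
    have h4 : ((wellInv q (-y) - wellInv q (-y) ^ q) ^ 2
        - 2 * excess q (wellInv q (-y)) * (1 - q * wellInv q (-y) ^ q / wellInv q (-y)))
          / (wellInv q (-y) - wellInv q (-y) ^ q) ^ 3 < -(q / (3 * (1 - q))) := by
      rw [div_lt_iff_of_neg (Odd.pow_neg (by decide) hUb)]
      linarith
    linarith

/-! ### The period of the positive oscillations -/

/-- Half of the period of the positive solution of radius `r` in the well. -/
noncomputable def wellHalfPeriod (q r : ℝ) : ℝ :=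
  ∫ x in (0)..(Real.pi / 2),
    (wellInvDeriv q (r * Real.sin x) + wellInvDeriv q (-(r * Real.sin x)))

lemma wellHalfPeriod_zero (hq0 : 0 < q) (hq1 : q < 1) :
    wellHalfPeriod q 0 = Real.pi / √(1 - q) := by
  simp only [wellHalfPeriod, zero_mul, neg_zero, wellInvDeriv_zero hq0 hq1,
    intervalIntegral.integral_const, smul_eq_mul]
  ring

/-- The travel time along the orbit of zero energy. -/
noncomputable def homoclinicTime (q x : ℝ) : ℝ :=
  2 / (1 - q) * Real.arcsin (√((1 + q) / 2) * x ^ ((1 - q) / 2))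

lemma sq_sqrt_mul_rpow (hq0 : 0 < q) {x : ℝ} (hx : 0 < x) :
    (√((1 + q) / 2) * x ^ ((1 - q) / 2)) ^ 2 = (1 + q) / 2 * (x / x ^ q) := by
  rw [mul_pow, Real.sq_sqrt (by positivity), div_rpow_eq hx, ← Real.rpow_natCast,
    ← Real.rpow_mul hx.le]
  congr 2
  push_cast
  ring

lemma wellRadius_sq_sub (hq0 : 0 < q) (hq1 : q < 1) (x : ℝ) :
    wellRadius q ^ 2 - 2 * excess q x = 2 / (1 + q) * (x * x ^ q) - x ^ 2 := by
  rw [wellRadius_sq hq0 hq1, excess]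
  field_simp
  ring

/-- With u = √((1+q)/2) x^((1-q)/2) the squared velocity on the zero level is (x/u)²(1-u²), so
dx/velocity is 2/(1-q) times the differential of arcsin u. -/
lemma hasDerivAt_homoclinicTime (hq0 : 0 < q) (hq1 : q < 1) {x : ℝ} (hx : 0 < x)
    (hE : 2 * excess q x < wellRadius q ^ 2) :
    HasDerivAt (homoclinicTime q) (√(wellRadius q ^ 2 - 2 * excess q x))⁻¹ x := by
  have hδ : 0 < 1 - q := by linarith
  have hsq := sq_sqrt_mul_rpow hq0 hx
  have hk : 0 < √((1 + q) / 2) := Real.sqrt_pos.2 (by positivity)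
  have hxd : 0 < x ^ ((1 - q) / 2) := Real.rpow_pos_of_pos hx _
  have ha : 0 < x ^ q := Real.rpow_pos_of_pos hx _
  have hfac : wellRadius q ^ 2 - 2 * excess q x
      = (x / (√((1 + q) / 2) * x ^ ((1 - q) / 2))) ^ 2
        * (1 - (√((1 + q) / 2) * x ^ ((1 - q) / 2)) ^ 2) := by
    rw [div_pow, hsq, wellRadius_sq_sub hq0 hq1]
    field_simp
  have hu1 : (√((1 + q) / 2) * x ^ ((1 - q) / 2)) ^ 2 < 1 := by
    have h0 : 0 < wellRadius q ^ 2 - 2 * excess q x := by linarith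
    rw [hfac] at h0
    have := pos_of_mul_pos_right h0 (sq_nonneg _)
    linarith
  have hu0 : 0 < √((1 + q) / 2) * x ^ ((1 - q) / 2) := by positivity
  have hu1' : √((1 + q) / 2) * x ^ ((1 - q) / 2) < 1 := by nlinarith
  have hu := (Real.hasDerivAt_rpow_const (p := (1 - q) / 2) (Or.inl hx.ne')).const_mul
    (√((1 + q) / 2))
  have := ((Real.hasDerivAt_arcsin (by linarith) hu1'.ne).comp x hu).const_mul (2 / (1 - q))
  refine this.congr_deriv ?_
  rw [hfac, Real.sqrt_mul (sq_nonneg _), Real.sqrt_sq (by positivity), Real.rpow_sub_one hx.ne']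
  have hs : 0 < √(1 - (√((1 + q) / 2) * x ^ ((1 - q) / 2)) ^ 2) := Real.sqrt_pos.2 (by linarith)
  generalize √(1 - (√((1 + q) / 2) * x ^ ((1 - q) / 2)) ^ 2) = R at *
  field_simp

lemma continuous_homoclinicTime (hq1 : q < 1) : Continuous (homoclinicTime q) :=
  continuous_const.mul (Real.continuous_arcsin.comp
    (continuous_const.mul (Real.continuous_rpow_const (by linarith))))

lemma homoclinicTime_zero (hq1 : q < 1) : homoclinicTime q 0 = 0 := by
  rw [homoclinicTime, Real.zero_rpow (by linarith)]
  simp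

lemma homoclinicTime_wellInv_wellRadius (hq0 : 0 < q) (hq1 : q < 1) :
    homoclinicTime q (wellInv q (wellRadius q)) = Real.pi / (1 - q) := by
  have hR := wellRadius_pos hq0 hq1
  have hx := wellInv_pos hq0 hq1 (y := wellRadius q) (by linarith)
  have h1 := two_mul_excess_wellInv hq0 hq1 (y := wellRadius q) (by linarith)
  have h2 := wellRadius_sq_sub hq0 hq1 (wellInv q (wellRadius q))
  rw [h1, sub_self] at h2
  have hsq := sq_sqrt_mul_rpow hq0 hx
  set x := wellInv q (wellRadius q)
  have ha : 0 < x ^ q := Real.rpow_pos_of_pos hx _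
  have h3 : (1 + q) / 2 * (x / x ^ q) = 1 := by
    have h4 : x * (2 / (1 + q) * x ^ q - x) = 0 := by linarith
    have h5 := (mul_eq_zero.1 h4).resolve_left hx.ne'
    have h6 : x = 2 / (1 + q) * x ^ q := by linarith
    field_simp
    field_simp at h6
    linarith
  rw [h3] at hsq
  have h0 : 0 ≤ √((1 + q) / 2) * x ^ ((1 - q) / 2) := by positivity
  have h7 : √((1 + q) / 2) * x ^ ((1 - q) / 2) = 1 := by nlinarith
  rw [homoclinicTime, h7, Real.arcsin_one]
  have : 1 - q ≠ 0 := by linarith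
  field_simp

lemma mul_sin_mem_Ico {r R x : ℝ} (hR : 0 < R) (hr : r ∈ Icc 0 R)
    (hx : x ∈ Ioo 0 (Real.pi / 2)) : r * Real.sin x ∈ Ico 0 R := by
  obtain ⟨h0, h1⟩ := sin_mem_Ioo hx
  exact ⟨mul_nonneg hr.1 h0.le, by nlinarith [hr.1, hr.2]⟩

lemma wellHalfPeriod_wellRadius (hq0 : 0 < q) (hq1 : q < 1) :
    IntervalIntegrable (fun x => wellInvDeriv q (wellRadius q * Real.sin x)
        + wellInvDeriv q (-(wellRadius q * Real.sin x))) volume 0 (Real.pi / 2) ∧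
      wellHalfPeriod q (wellRadius q) = Real.pi / (1 - q) := by
  set R := wellRadius q with hRdef
  have hR : 0 < R := wellRadius_pos hq0 hq1
  have hSc := continuous_wellInv hq0 hq1
  have hJc := continuous_homoclinicTime hq1
  have hcomp : ∀ y ∈ Ioo (-R) R, HasDerivAt (fun y => homoclinicTime q (wellInv q y))
      ((√(R ^ 2 - y ^ 2))⁻¹ * wellInvDeriv q y) y := fun y hy => by
    have h2 := two_mul_excess_wellInv hq0 hq1 hy.1.le
    have h3 : y ^ 2 < R ^ 2 := sq_lt_sq' hy.1 hy.2
    have h := (hasDerivAt_homoclinicTime hq0 hq1 (wellInv_pos hq0 hq1 hy.1)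
      (by rw [h2]; exact h3)).comp y (hasDerivAt_wellInv hq0 hq1 hy.1)
    rwa [h2] at h
  -- Travel time on the zero level between the positions with well coordinates -R sin x and R sin x.
  -- Since √(R² - (R sin x)²) = R cos x, its derivative is the integrand; at x = π/2 it is the time
  -- from 0 to the maximum.
  let F : ℝ → ℝ := fun x => homoclinicTime q (wellInv q (R * Real.sin x))
    - homoclinicTime q (wellInv q (-(R * Real.sin x)))
  have hF : Continuous F := by
    refine (hJc.comp (hSc.comp ?_)).sub (hJc.comp (hSc.comp ?_)) <;> fun_prop
  have hd : ∀ x ∈ Ioo 0 (Real.pi / 2), HasDerivAt F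
      (wellInvDeriv q (R * Real.sin x) + wellInvDeriv q (-(R * Real.sin x))) x := fun x hx => by
    obtain ⟨h0, h1⟩ := mul_sin_mem_Ico hR ⟨hR.le, le_rfl⟩ hx
    have hcos : 0 < Real.cos x := Real.cos_pos_of_mem_Ioo ⟨by linarith [hx.1, Real.pi_pos], hx.2⟩
    have hsq : √(R ^ 2 - (R * Real.sin x) ^ 2) = R * Real.cos x := by
      rw [show R ^ 2 - (R * Real.sin x) ^ 2 = (R * Real.cos x) ^ 2 by
        rw [mul_pow, mul_pow, Real.cos_sq']; ring, Real.sqrt_sq (by positivity)]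
    have hs := (Real.hasDerivAt_sin x).const_mul R
    have d1 := (hcomp (R * Real.sin x) ⟨by linarith, h1⟩).comp x hs
    have d2 := (hcomp (-(R * Real.sin x)) ⟨by linarith, by linarith⟩).comp x hs.neg
    refine (d1.sub d2).congr_deriv ?_
    rw [neg_sq, hsq]
    field_simp
    ring
  obtain ⟨h1, h2⟩ := integrable_and_integral_of_deriv_nonneg (by positivity) hF.continuousOn hd
    (fun x hx => by
      obtain ⟨h0, h1⟩ := mul_sin_mem_Ico hR ⟨hR.le, le_rfl⟩ hx
      exact (add_pos (wellInvDeriv_pos hq0 hq1 (by linarith))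
        (wellInvDeriv_pos hq0 hq1 (by linarith))).le)
  refine ⟨h1, ?_⟩
  rw [wellHalfPeriod, h2]
  simp only [F, Real.sin_pi_div_two, Real.sin_zero, mul_one, mul_zero, neg_zero, sub_self,
    sub_zero]
  rw [hRdef, homoclinicTime_wellInv_wellRadius hq0 hq1, wellInv_neg_wellRadius hq0 hq1,
    homoclinicTime_zero hq1, sub_zero]

lemma wellHalfPeriod_strictMonoOn_continuousOn (hq0 : 0 < q) (hq1 : q < 1) :
    StrictMonoOn (wellHalfPeriod q) (Icc 0 (wellRadius q)) ∧
      ContinuousOn (wellHalfPeriod q) (Icc 0 (wellRadius q)) := by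
  have hR := wellRadius_pos hq0 hq1
  have hc1 : ∀ x ∈ Ioo 0 (Real.pi / 2), ∀ r ∈ Icc 0 (wellRadius q),
      ContinuousAt (wellInvDeriv q) (r * Real.sin x) ∧
        ContinuousAt (wellInvDeriv q) (-(r * Real.sin x)) := fun x hx r hr => by
    obtain ⟨h0, h1⟩ := mul_sin_mem_Ico hR hr hx
    exact ⟨continuousAt_wellInvDeriv hq0 hq1 (by linarith),
      continuousAt_wellInvDeriv hq0 hq1 (by linarith)⟩
  refine integral_strictMonoOn_continuousOn
    (p := fun r x => wellInvDeriv q (r * Real.sin x) + wellInvDeriv q (-(r * Real.sin x)))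
    (by positivity) hR.le ?_ ?_ ?_ ?_ (wellHalfPeriod_wellRadius hq0 hq1).1
  · intro x hx r hr s hs hrs
    refine wellInvDeriv_add_strictMonoOn hq0 hq1 (mul_sin_mem_Ico hR hr hx)
      (mul_sin_mem_Ico hR hs hx) ?_
    exact mul_lt_mul_of_pos_right hrs (sin_mem_Ioo hx).1
  · intro x hx r hr
    obtain ⟨h1, h2⟩ := hc1 x hx r hr
    exact ((h1.comp (f := fun r => r * Real.sin x) (by fun_prop)).add
      (h2.comp (f := fun r => -(r * Real.sin x)) (by fun_prop))).continuousWithinAt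
  · intro r hr x hx
    obtain ⟨h1, h2⟩ := hc1 x hx r hr
    exact ((h1.comp (f := fun x => r * Real.sin x) (by fun_prop)).add
      (h2.comp (f := fun x => -(r * Real.sin x)) (by fun_prop))).continuousWithinAt
  · intro x _
    have := (wellInvDeriv_pos hq0 hq1 (y := 0) (by linarith)).le
    simpa using this

/-- For every radius in the well there is a positive oscillation that fills the whole level set of
the energy in the right half-plane. -/
theorem exists_positive_solution (hq0 : 0 < q) (hq1 : q < 1) {r : ℝ} (hr0 : 0 < r)
    (hr1 : r < wellRadius q) :
    ∃ w : ℝ → ℝ, IsODESolution 1 1 q w ∧ (∀ t, 0 < w t) ∧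
      (∀ x y, 0 < x → energy q x y = potential q 1 + r ^ 2 / 2 → ∃ t, w t = x ∧ deriv w t = y) ∧
      Function.Periodic w (2 * wellHalfPeriod q r) ∧
      ∀ S, 0 < S → Function.Periodic w S →
        ∃ n : ℕ, 1 ≤ n ∧ S = n * (2 * wellHalfPeriod q r) := by
  have hlow : ∀ x, -wellRadius q < r * Real.sin x := fun x => by
    nlinarith [Real.neg_one_le_sin x]
  have hcont : Continuous fun x => wellInvDeriv q (r * Real.sin x) :=
    continuous_iff_continuousAt.2 fun x =>
      (continuousAt_wellInvDeriv hq0 hq1 (hlow x)).comp (f := fun x => r * Real.sin x)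
        (by fun_prop)
  have hper : Function.Periodic (fun x => wellInvDeriv q (r * Real.sin x)) (2 * Real.pi) :=
    fun x => by simp
  -- In the coordinates (`wellCoord`, velocity) the orbit is the circle (r sin x, r cos x), run
  -- through at angular speed 1/S'(r sin x).
  obtain ⟨w, hw, horb, horb', hwper, hmult⟩ := exists_solution_of_parametrization hq0
    (g := fun x => wellInvDeriv q (r * Real.sin x)) (Φ := fun x => wellInv q (r * Real.sin x))
    (Ψ := fun x => r * Real.cos x) hcont (fun x => wellInvDeriv_pos hq0 hq1 (hlow x)) hper
    (fun x => ((hasDerivAt_wellInv hq0 hq1 (hlow x)).comp x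
      ((Real.hasDerivAt_sin x).const_mul r)).congr_deriv (by ring))
    (fun x => ((Real.hasDerivAt_cos x).const_mul r).congr_deriv (by
      rw [force_mul_wellInvDeriv hq0 hq1 (hlow x)]
      ring))
    (fun x => by simp) (fun x hx => by
      have h1 : Real.sin x = 1 := by
        have := mul_left_cancel₀ hr0.ne' ((strictMono_wellInv hq0 hq1).injective hx)
        rwa [Real.sin_pi_div_two] at this
      obtain ⟨n, hn⟩ := Real.sin_eq_one_iff.1 h1
      exact ⟨n, hn.symm⟩)
  have hT : ∫ x in (0)..(2 * Real.pi), wellInvDeriv q (r * Real.sin x)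
      = 2 * wellHalfPeriod q r := by
    rw [integral_eq_two_mul_of_sine_symmetry hcont hper (fun x => by simp), wellHalfPeriod]
    simp
  rw [hT] at hwper hmult
  refine ⟨w, hw, fun t => ?_, fun x y hx hxy => ?_, hwper, hmult⟩
  · obtain ⟨x, hx, -⟩ := horb' t
    rw [hx]
    exact wellInv_pos hq0 hq1 (hlow x)
  · have h1 := wellCoord_sq hq0 hq1 hx.le
    rw [excess_eq hq0 hx.le] at h1
    rw [energy] at hxy
    have h2 : (wellCoord q x / r) ^ 2 + (y / r) ^ 2 = 1 := by
      field_simp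
      linarith
    have hs1 : -1 ≤ wellCoord q x / r := by nlinarith [sq_nonneg (y / r)]
    have hs2 : wellCoord q x / r ≤ 1 := by nlinarith [sq_nonneg (y / r)]
    have hsin := Real.sin_arcsin hs1 hs2
    set x₀ := Real.arcsin (wellCoord q x / r)
    have hrx : r * Real.sin x₀ = wellCoord q x := by
      rw [hsin]
      field_simp
    have hy2 : (y / r) ^ 2 = Real.cos x₀ ^ 2 := by
      rw [Real.cos_sq', hsin]
      linarith
    rcases sq_eq_sq_iff_eq_or_eq_neg.1 hy2 with h | h
    · obtain ⟨t, ht1, ht2⟩ := horb x₀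
      refine ⟨t, by rw [ht1, hrx, wellInv_wellCoord hq0 hq1], ?_⟩
      rw [ht2, ← h]
      field_simp
    · obtain ⟨t, ht1, ht2⟩ := horb (Real.pi - x₀)
      refine ⟨t, by rw [ht1, Real.sin_pi_sub, hrx, wellInv_wellCoord hq0 hq1], ?_⟩
      rw [ht2, Real.cos_pi_sub, ← h]
      field_simp

/-! ### The explicit solution of zero energy -/

/-- Needed for the velocity of `bump`, where a = 2q/(1-q) may be less than 1 and |x|^a alone is not
differentiable at 0; the vanishing factor x repairs this. -/
lemma hasDerivAt_abs_rpow_mul_self {a : ℝ} (ha : 0 < a) (x : ℝ) :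
    HasDerivAt (fun x : ℝ => |x| ^ a * x) ((a + 1) * |x| ^ a) x := by
  by_cases hx : x = 0
  · subst hx
    have hc : ContinuousAt (fun x : ℝ => |x| ^ a) 0 :=
      ((Real.continuous_rpow_const ha.le).comp continuous_abs).continuousAt
    have h := hasDerivAt_mul_of_eq_zero (hasDerivAt_id (0 : ℝ)) rfl hc
    simp only [mul_comm (|_| ^ a)]
    exact h.congr_deriv (by simp [Real.zero_rpow ha.ne'])
  · have habs : |x| ≠ 0 := abs_ne_zero.2 hx
    have h1 := ((hasDerivAt_abs hx).rpow_const (p := a) (Or.inl habs)).mul (hasDerivAt_id x)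
    refine h1.congr_deriv ?_
    have h2 : (SignType.sign x : ℝ) * x = |x| := sign_mul_self x
    rw [Real.rpow_sub_one habs]
    simp only [id]
    field_simp
    linear_combination a * h2

lemma force_of_nonneg (hq0 : 0 < q) {x : ℝ} (hx : 0 ≤ x) : force q x = x ^ q - x := by
  rcases hx.eq_or_lt with rfl | h
  · simp [force, Real.zero_rpow hq0.ne']
  · exact force_of_pos h

/-- The maximum of the solution of zero energy. -/
noncomputable def bumpHeight (q : ℝ) : ℝ := (2 / (1 + q)) ^ (1 / (1 - q))

/-- The nonnegative solution of zero energy. -/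
noncomputable def bump (q t : ℝ) : ℝ :=
  bumpHeight q * |Real.sin ((1 - q) / 2 * t)| ^ (2 / (1 - q))

/-- The period of `bump`. -/
noncomputable def bumpPeriod (q : ℝ) : ℝ := 2 * Real.pi / (1 - q)

lemma bumpPeriod_pos (hq1 : q < 1) : 0 < bumpPeriod q :=
  div_pos (by positivity) (by linarith)

lemma bumpHeight_pos (hq0 : 0 < q) : 0 < bumpHeight q := by
  rw [bumpHeight]
  positivity

lemma bumpHeight_rpow (hq0 : 0 < q) (hq1 : q < 1) : bumpHeight q ^ (1 - q) = 2 / (1 + q) := by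
  have : 1 - q ≠ 0 := by linarith
  rw [bumpHeight, ← Real.rpow_mul (by positivity), one_div_mul_cancel this, Real.rpow_one]

lemma bump_nonneg (hq0 : 0 < q) (t : ℝ) : 0 ≤ bump q t :=
  mul_nonneg (bumpHeight_pos hq0).le (Real.rpow_nonneg (abs_nonneg _) _)

lemma bump_eq_zero_iff (hq0 : 0 < q) (hq1 : q < 1) {t : ℝ} :
    bump q t = 0 ↔ ∃ n : ℤ, t = n * bumpPeriod q := by
  have hδ : 1 - q ≠ 0 := by linarith
  rw [bump, mul_eq_zero, or_iff_right (bumpHeight_pos hq0).ne',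
    Real.rpow_eq_zero (abs_nonneg _) (div_ne_zero two_ne_zero hδ), abs_eq_zero,
    Real.sin_eq_zero_iff]
  refine exists_congr fun n => ?_
  rw [bumpPeriod]
  field_simp
  constructor <;> intro h <;> linarith

lemma bump_add_period (hq1 : q < 1) (t : ℝ) : bump q (t + bumpPeriod q) = bump q t := by
  have hδ : 1 - q ≠ 0 := by linarith
  have : (1 - q) / 2 * (t + bumpPeriod q) = (1 - q) / 2 * t + Real.pi := by
    rw [bumpPeriod]
    field_simp
  rw [bump, this, Real.sin_add_pi, abs_neg, bump]

lemma bump_neg (t : ℝ) : bump q (-t) = bump q t := by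
  simp [bump]

lemma isODESolution_bump (hq0 : 0 < q) (hq1 : q < 1) : IsODESolution 1 1 q (bump q) := by
  have hδ : 0 < 1 - q := by linarith
  have hp : 1 < 2 / (1 - q) := by rw [lt_div_iff₀ hδ]; linarith
  have hp2 : 0 < 2 / (1 - q) - 2 := by
    rw [sub_pos, lt_div_iff₀ hδ]
    linarith
  have hA := bumpHeight_pos hq0
  have hsin : ∀ t, HasDerivAt (fun t => Real.sin ((1 - q) / 2 * t))
      (Real.cos ((1 - q) / 2 * t) * ((1 - q) / 2)) t := fun t => by
    have h := ((hasDerivAt_id t).const_mul ((1 - q) / 2)).sin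
    simpa using h
  have hcos : ∀ t, HasDerivAt (fun t => Real.cos ((1 - q) / 2 * t))
      (-Real.sin ((1 - q) / 2 * t) * ((1 - q) / 2)) t := fun t => by
    have h := ((hasDerivAt_id t).const_mul ((1 - q) / 2)).cos
    simpa using h
  refine isODESolution_of_hasDerivAt hq0
    (z := fun t => bumpHeight q * (|Real.sin ((1 - q) / 2 * t)| ^ (2 / (1 - q) - 2)
      * Real.sin ((1 - q) / 2 * t) * Real.cos ((1 - q) / 2 * t))) (fun t => ?_) (fun t => ?_)
  · refine (((hasDerivAt_abs_rpow _ hp).comp t (hsin t)).const_mul (bumpHeight q)).congr_deriv ?_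
    field_simp
  · refine ((((hasDerivAt_abs_rpow_mul_self hp2 _).comp t (hsin t)).mul (hcos t)).const_mul
      (bumpHeight q)).congr_deriv ?_
    rw [force_of_nonneg hq0 (bump_nonneg hq0 t), bump,
      Real.mul_rpow hA.le (Real.rpow_nonneg (abs_nonneg _) _), ← Real.rpow_mul (abs_nonneg _)]
    have h1 : 2 / (1 - q) * q = 2 / (1 - q) - 2 := by
      field_simp
      ring
    have h2 : |Real.sin ((1 - q) / 2 * t)| ^ (2 / (1 - q))
        = |Real.sin ((1 - q) / 2 * t)| ^ (2 / (1 - q) - 2) * Real.sin ((1 - q) / 2 * t) ^ 2 := by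
      rw [← sq_abs (Real.sin _), ← Real.rpow_natCast (|Real.sin _|),
        ← Real.rpow_add_of_nonneg (abs_nonneg _) hp2.le (by positivity)]
      congr 1
      push_cast
      ring
    have h3 : bumpHeight q ^ q = (1 + q) / 2 * bumpHeight q := by
      have h4 := bumpHeight_rpow hq0 hq1
      rw [← div_rpow_eq hA] at h4
      have : 0 < bumpHeight q ^ q := Real.rpow_pos_of_pos hA _
      field_simp at h4 ⊢
      linarith
    rw [h1, h2, h3]
    simp only [Function.comp_apply]
    have h5 := Real.sin_sq_add_cos_sq ((1 - q) / 2 * t)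
    generalize |Real.sin ((1 - q) / 2 * t)| ^ (2 / (1 - q) - 2) = P
    generalize Real.sin ((1 - q) / 2 * t) = s at *
    generalize Real.cos ((1 - q) / 2 * t) = c at *
    have h6 : c ^ 2 = 1 - s ^ 2 := by linarith
    field_simp
    linear_combination (P * (1 + q)) * h6

lemma energy_bump (hq0 : 0 < q) (hq1 : q < 1) (t : ℝ) :
    energy q (bump q t) (deriv (bump q) t) = 0 := by
  have h0 : bump q 0 = 0 := (bump_eq_zero_iff hq0 hq1).2 ⟨0, by simp⟩
  have h1 : deriv (bump q) 0 = 0 := by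
    refine IsLocalMin.deriv_eq_zero (Eventually.of_forall fun s => ?_)
    rw [h0]
    exact bump_nonneg hq0 s
  rw [energy_eq hq0 (isODESolution_bump hq0 hq1) t 0, h0, h1, energy, potential_zero hq0]
  simp

lemma deriv_bump_neg (t : ℝ) : deriv (bump q) (-t) = -deriv (bump q) t := by
  have h : (fun t => bump q (-t)) = bump q := funext bump_neg
  have h2 := deriv_comp_neg (bump q) t
  rw [h] at h2
  linarith

lemma deriv_bump_add_period (hq1 : q < 1) (t : ℝ) :
    deriv (bump q) (t + bumpPeriod q) = deriv (bump q) t := by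
  have h : (fun t => bump q (t + bumpPeriod q)) = bump q := funext (bump_add_period hq1)
  have h2 := deriv_comp_add_const (f := bump q) (bumpPeriod q) t
  rw [h] at h2
  exact h2.symm

lemma le_bumpHeight (hq0 : 0 < q) (hq1 : q < 1) {x y : ℝ} (hx : 0 < x) (h : energy q x y = 0) :
    x ≤ bumpHeight q := by
  have hδ : 0 < 1 - q := by linarith
  rw [← Real.rpow_le_rpow_iff hx.le (bumpHeight_pos hq0).le hδ, bumpHeight_rpow hq0 hq1,
    ← div_rpow_eq hx]
  have ha : 0 < x ^ q := Real.rpow_pos_of_pos hx _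
  rw [energy, potential, abs_of_pos hx, Real.rpow_add hx, Real.rpow_one] at h
  have h1 : x * (x / 2 - x ^ q / (1 + q)) ≤ 0 := by
    have : x * (x / 2 - x ^ q / (1 + q)) = -(y ^ 2 / 2) := by linear_combination h
    rw [this]
    nlinarith [sq_nonneg y]
  have h2 : x / 2 - x ^ q / (1 + q) ≤ 0 := by
    by_contra! hc
    nlinarith [mul_pos hx hc]
  rw [div_le_iff₀ ha]
  have : 2 / (1 + q) * x ^ q = 2 * (x ^ q / (1 + q)) := by ring
  linarith

lemma exists_bump_eq (hq0 : 0 < q) (hq1 : q < 1) {x y : ℝ} (hx : 0 < x) (h : energy q x y = 0) :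
    ∃ t ∈ Ioo 0 (bumpPeriod q), bump q t = x ∧ deriv (bump q) t = y := by
  have hL := bumpPeriod_pos hq1
  have hδ : 1 - q ≠ 0 := by linarith
  have h0 : bump q 0 = 0 := (bump_eq_zero_iff hq0 hq1).2 ⟨0, by simp⟩
  have h1 : bump q (bumpPeriod q / 2) = bumpHeight q := by
    rw [bump, bumpPeriod, show (1 - q) / 2 * (2 * Real.pi / (1 - q) / 2) = Real.pi / 2 by
      field_simp]
    simp
  -- The rising half of the bump takes every height up to the maximum; the opposite velocity is
  -- found at the mirror time L - t.
  obtain ⟨t, ht, htx⟩ := intermediate_value_Icc (by linarith : 0 ≤ bumpPeriod q / 2)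
    (isODESolution_bump hq0 hq1).1.continuous.continuousOn
    (show x ∈ Icc (bump q 0) (bump q (bumpPeriod q / 2)) by
      rw [h0, h1]
      exact ⟨hx.le, le_bumpHeight hq0 hq1 hx h⟩)
  have ht0 : t ≠ 0 := by
    rintro rfl
    rw [h0] at htx
    exact hx.ne htx
  have ht' : 0 < t := lt_of_le_of_ne ht.1 ht0.symm
  have hE := energy_bump hq0 hq1 t
  rw [htx, ← h, energy, energy] at hE
  have hsq : y ^ 2 = deriv (bump q) t ^ 2 := by linarith
  rcases sq_eq_sq_iff_eq_or_eq_neg.1 hsq with hy | hy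
  · exact ⟨t, ⟨ht', by linarith [ht.2]⟩, htx, hy.symm⟩
  · refine ⟨-t + bumpPeriod q, ⟨by linarith [ht.2], by linarith⟩, ?_, ?_⟩
    · rw [bump_add_period hq1, bump_neg, htx]
    · rw [deriv_bump_add_period hq1, deriv_bump_neg, hy]

lemma bump_pos (hq0 : 0 < q) (hq1 : q < 1) {t : ℝ} (ht : t ∈ Ioo 0 (bumpPeriod q)) :
    0 < bump q t := by
  refine lt_of_le_of_ne (bump_nonneg hq0 t) fun h => ?_
  obtain ⟨n, hn⟩ := (bump_eq_zero_iff hq0 hq1).1 h.symm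
  have hL := bumpPeriod_pos hq1
  rw [hn] at ht
  have h1 : (0 : ℝ) < n := pos_of_mul_pos_left ht.1 hL.le
  have h2 : (n : ℝ) < 1 := by nlinarith [ht.2]
  have h3 : 0 < n := by exact_mod_cast h1
  have h4 : n < 1 := by exact_mod_cast h2
  omega

/-- A solution of zero energy is a copy of `bump` around each point where it is positive. -/
lemma exists_shift_eq_bump (hq0 : 0 < q) (hq1 : q < 1) {v : ℝ → ℝ} (hv : IsODESolution 1 1 q v)
    {t₀ : ℝ} (hE : energy q (v t₀) (deriv v t₀) = 0) (hpos : 0 < v t₀) :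
    ∃ σ, t₀ + σ ∈ Ioo 0 (bumpPeriod q) ∧
      ∀ t, t + σ ∈ Icc 0 (bumpPeriod q) → v t = bump q (t + σ) := by
  obtain ⟨t₁, ht₁, h0, h1⟩ := exists_bump_eq hq0 hq1 hpos hE
  have hu := isODESolution_shift hq0 hv (t₀ - t₁)
  have hW := isODESolution_bump hq0 hq1
  have hd : deriv (fun t => v (t + (t₀ - t₁))) t₁ = deriv v t₀ := by
    rw [deriv_comp_add_const]
    congr 1
    ring
  have heq := eqOn_of_phase_ne_zero hq0 hu hW isPreconnected_Ioo
    (fun t ht => Or.inl (bump_pos hq0 hq1 ht).ne') ht₁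
    (by rw [h0]; congr 1; ring) (by rw [hd, h1])
  -- Uniqueness holds on the open interval where the bump is positive; continuity adds the
  -- endpoints. Nothing follows beyond them, since the orbit reaches the origin.
  have heq' := heq.closure hu.1.continuous hW.1.continuous
  rw [closure_Ioo (bumpPeriod_pos hq1).ne] at heq'
  refine ⟨t₁ - t₀, by simpa using ht₁, fun t ht => ?_⟩
  rw [← heq' ht]
  congr 1
  ring

/-! ### Classification of solutions by energy -/

lemma hasLeastPeriod_of_multiples {w : ℝ → ℝ} {T : ℝ} (hT : 0 < T) (hper : Function.Periodic w T)
    (hmult : ∀ S, 0 < S → Function.Periodic w S → ∃ n : ℕ, 1 ≤ n ∧ S = n * T) :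
    HasLeastPeriod w T := by
  refine ⟨⟨hT, hper⟩, fun S hS => ?_⟩
  obtain ⟨n, hn, rfl⟩ := hmult S hS.1 hS.2
  have : (1 : ℝ) ≤ n := by exact_mod_cast hn
  nlinarith

lemma periodic_shift_iff {v w : ℝ → ℝ} {τ : ℝ} (h : ∀ t, v t = w (t + τ)) {S : ℝ} :
    Function.Periodic v S ↔ Function.Periodic w S := by
  refine ⟨fun hp t => ?_, fun hp t => ?_⟩
  · have := hp (t - τ)
    rw [h, h] at this
    convert this using 2 <;> ring
  · rw [h, h, ← hp (t + τ)]
    congr 1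
    ring

lemma not_isConstantFun_of_hasLeastPeriod {w : ℝ → ℝ} {T : ℝ} (h : HasLeastPeriod w T) :
    ¬ IsConstantFun w := by
  rintro ⟨a, ha⟩
  have hT := h.1.1
  have := h.2 (show T / 2 ∈ _ from ⟨by linarith, fun t => by rw [ha, ha]⟩)
  linarith

/-- The orbit of w never meets the origin, so uniqueness holds on the whole line and one common
phase point suffices. -/
lemma isTimeShift_of_phase_eq (hq0 : 0 < q) {v w : ℝ → ℝ} (hv : IsODESolution 1 1 q v)
    (hw : IsODESolution 1 1 q w) (hne : ∀ t, w t ≠ 0 ∨ deriv w t ≠ 0)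
    (h : ∃ t, w t = v 0 ∧ deriv w t = deriv v 0) : IsTimeShift v w := by
  obtain ⟨τ, h0, h1⟩ := h
  have hu := isODESolution_shift hq0 hw τ
  have hd : ∀ t, deriv (fun t => w (t + τ)) t = deriv w (t + τ) := fun t =>
    deriv_comp_add_const w τ t
  have := eqOn_of_phase_ne_zero hq0 hv hu isPreconnected_univ
    (fun t _ => by rw [hd]; exact hne (t + τ)) (mem_univ 0)
    (by simp [h0]) (by rw [hd, zero_add, h1])
  exact ⟨τ, fun t => this (mem_univ t)⟩

lemma amplitudeParam_pos (hq0 : 0 < q) {A : ℝ} (hA : 0 < A) : 0 < amplitudeParam q A := by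
  rw [amplitudeParam]
  positivity

lemma exists_amplitude (hq0 : 0 < q) (hq1 : q < 1) {e : ℝ} (he : 0 < e) :
    ∃ A, 0 < A ∧ amplitudeParam q A < 1 ∧ potential q A = e := by
  obtain ⟨B, hBe, hB0⟩ := (((tendsto_potential_atTop hq1).eventually_ge_atTop e).and
    (eventually_ge_atTop 0)).exists
  obtain ⟨A, hA, hAe⟩ := intermediate_value_Icc hB0 (continuous_potential hq0).continuousOn
    (show e ∈ Icc (potential q 0) (potential q B) from
      ⟨by rw [potential_zero hq0]; exact he.le, hBe⟩)
  have hA0 : 0 < A := by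
    refine lt_of_le_of_ne hA.1 ?_
    rintro rfl
    rw [potential_zero hq0] at hAe
    exact he.ne hAe
  refine ⟨A, hA0, ?_, hAe⟩
  have h := potential_amplitude_sub hq0 hA0 0
  rw [mul_zero, potential_zero hq0, abs_zero, Real.zero_rpow (by linarith), hAe] at h
  by_contra! hc
  nlinarith [sq_nonneg A]

lemma eq_of_amplitudeParam_eq (hq0 : 0 < q) (hq1 : q < 1) {A B : ℝ} (hA : 0 < A) (hB : 0 < B)
    (h : amplitudeParam q A = amplitudeParam q B) : A = B := by
  have h1 : A ^ (q - 1) = B ^ (q - 1) := mul_left_cancel₀ (by positivity) h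
  exact Real.rpow_left_injOn (by linarith : q - 1 ≠ 0) hA.le hB.le h1

lemma energy_nonneg_of_zero (hq0 : 0 < q) {v : ℝ → ℝ} (hv : IsODESolution 1 1 q v) {t : ℝ}
    (h : v t = 0) (s : ℝ) : 0 ≤ energy q (v s) (deriv v s) := by
  rw [energy_eq hq0 hv s t, h, energy, potential_zero hq0]
  positivity

lemma exists_zero_of_isSignChanging {v : ℝ → ℝ} (hc : Continuous v) (h : IsSignChanging v) :
    ∃ t, v t = 0 := by
  obtain ⟨⟨a, ha⟩, b, hb⟩ := h
  exact mem_range_of_exists_le_of_exists_ge hc ⟨b, hb.le⟩ ⟨a, ha.le⟩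

/-- A sign-changing solution of zero energy has no period shorter than two bumps. -/
lemma two_mul_bumpPeriod_le (hq0 : 0 < q) (hq1 : q < 1) {v : ℝ → ℝ} (hv : IsODESolution 1 1 q v)
    (hE : ∀ t, energy q (v t) (deriv v t) = 0) (hs : IsSignChanging v) {S : ℝ} (hS : 0 < S)
    (hper : Function.Periodic v S) : 2 * bumpPeriod q ≤ S := by
  obtain ⟨⟨a, ha⟩, b, hb⟩ := hs
  have hL := bumpPeriod_pos hq1
  obtain ⟨σ, -, hσ⟩ := exists_shift_eq_bump hq0 hq1 hv (hE a) ha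
  obtain ⟨ρ, -, hρ⟩ := exists_shift_eq_bump hq0 hq1 (isODESolution_neg hq0 hv) (t₀ := b)
    (by
      have := hE b
      simp only [energy, potential_neg, deriv.fun_neg, neg_sq] at this ⊢
      exact this) (by linarith)
  have hpos : ∀ t, t + σ ∈ Ioo 0 (bumpPeriod q) → 0 < v t := fun t ht => by
    rw [hσ t (Ioo_subset_Icc_self ht)]
    exact bump_pos hq0 hq1 ht
  have hneg : ∀ t, t + ρ ∈ Ioo 0 (bumpPeriod q) → v t < 0 := fun t ht => by
    have h1 := hρ t (Ioo_subset_Icc_self ht)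
    have h2 := bump_pos hq0 hq1 ht
    linarith
  -- The positive bump starts at -σ, the negative one at -ρ. Periodicity moves the negative one so
  -- that it starts at β in [-σ, -σ + S), between the positive bump and its next copy. Bumps of
  -- opposite sign cannot overlap, so two lengths fit into S.
  obtain ⟨n, hn, -⟩ := existsUnique_add_zsmul_mem_Ico hS (-ρ) (-σ)
  simp only [zsmul_eq_mul] at hn
  have hneg' : ∀ t, t - (-ρ + n * S) ∈ Ioo 0 (bumpPeriod q) → v t < 0 := fun t ht => by
    rw [← hper.sub_zsmul_eq n]
    refine hneg _ ?_
    rw [zsmul_eq_mul]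
    convert ht using 1
    ring
  have hpos' : ∀ t, t - (-σ + S) ∈ Ioo 0 (bumpPeriod q) → 0 < v t := fun t ht => by
    rw [← hper.sub_eq]
    refine hpos _ ?_
    convert ht using 1
    ring
  set β := -ρ + n * S
  have h1 : -σ + bumpPeriod q ≤ β := by
    by_contra! hc
    -- The midpoint of the overlap, where both signs would hold.
    let t := (β + (-σ + bumpPeriod q)) / 2
    have ht1 := hneg' t ⟨by simp only [t]; linarith, by simp only [t]; linarith [hn.1]⟩
    have ht2 := hpos t ⟨by simp only [t]; linarith [hn.1], by simp only [t]; linarith⟩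
    linarith
  have h2 : β + bumpPeriod q ≤ -σ + S := by
    by_contra! hc
    let t := ((-σ + S) + (β + bumpPeriod q)) / 2
    have ht1 := hneg' t ⟨by simp only [t]; linarith [hn.2], by simp only [t]; linarith [hn.2]⟩
    have ht2 := hpos' t ⟨by simp only [t]; linarith, by simp only [t]; linarith [hn.2]⟩
    linarith
  linarith

lemma signQuarterPeriod_mem_Ioo (hq0 : 0 < q) (hq1 : q < 1) {c : ℝ} (hc : c ∈ Ioo (0 : ℝ) 1) :
    4 * signQuarterPeriod q c ∈ Ioo (2 * Real.pi) (2 * bumpPeriod q) := by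
  have hm := (signQuarterPeriod_strictMonoOn_continuousOn hq0 hq1).1
  have h0 := hm (left_mem_Icc.2 zero_le_one) (Ioo_subset_Icc_self hc) hc.1
  have h1 := hm (Ioo_subset_Icc_self hc) (right_mem_Icc.2 zero_le_one) hc.2
  rw [signQuarterPeriod_zero] at h0
  rw [(signQuarterPeriod_one hq1).2] at h1
  refine ⟨by linarith, ?_⟩
  rw [bumpPeriod, show 2 * (2 * Real.pi / (1 - q)) = 4 * (Real.pi / (1 - q)) by ring]
  linarith

theorem two_pi_lt_of_isSignChanging (hq0 : 0 < q) (hq1 : q < 1) {v : ℝ → ℝ}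
    (hv : IsODESolution 1 1 q v) (hs : IsSignChanging v) {S : ℝ} (hS : 0 < S)
    (hper : Function.Periodic v S) : 2 * Real.pi < S := by
  obtain ⟨t₀, ht₀⟩ := exists_zero_of_isSignChanging hv.1.continuous hs
  have hE := energy_nonneg_of_zero hq0 hv ht₀
  rcases (hE 0).eq_or_lt with h | h
  · have := two_mul_bumpPeriod_le hq0 hq1 hv
      (fun t => by rw [energy_eq hq0 hv t 0, ← h]) hs hS hper
    refine lt_of_lt_of_le ?_ this
    have hδ : 0 < 1 - q := by linarith
    have hπ := Real.pi_pos
    rw [bumpPeriod, mul_div_assoc', lt_div_iff₀ hδ]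
    nlinarith
  · obtain ⟨A, hA, hc, hAE⟩ := exists_amplitude hq0 hq1 h
    obtain ⟨w, hw, -, horb, hne, -, hmult⟩ := exists_signChanging_solution hq0 hq1 hA hc
    obtain ⟨τ, hτ⟩ := isTimeShift_of_phase_eq hq0 hv hw hne (horb _ _ hAE.symm)
    obtain ⟨n, hn, rfl⟩ := hmult S hS ((periodic_shift_iff hτ).1 hper)
    have hn' : (1 : ℝ) ≤ n := by exact_mod_cast hn
    have := (signQuarterPeriod_mem_Ioo hq0 hq1 ⟨amplitudeParam_pos hq0 hA, hc⟩).1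
    have hπ := Real.pi_pos
    nlinarith

theorem existsUnique_signChanging (hq0 : 0 < q) (hq1 : q < 1) {T : ℝ}
    (hT : T ∈ Ioo (2 * Real.pi) (2 * bumpPeriod q)) :
    ∃ w : ℝ → ℝ, (IsODESolution 1 1 q w ∧ HasLeastPeriod w T ∧ IsSignChanging w) ∧
      ∀ v : ℝ → ℝ, IsODESolution 1 1 q v → HasLeastPeriod v T → IsSignChanging v →
        IsTimeShift v w := by
  have hπ := Real.pi_pos
  have hT0 : 0 < T := by linarith [hT.1]
  obtain ⟨hm, hcont⟩ := signQuarterPeriod_strictMonoOn_continuousOn hq0 hq1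
  obtain ⟨c, hc, hcT⟩ := intermediate_value_Ioo zero_le_one hcont
    (show T / 4 ∈ Ioo (signQuarterPeriod q 0) (signQuarterPeriod q 1) by
      rw [signQuarterPeriod_zero, (signQuarterPeriod_one hq1).2]
      refine ⟨by linarith [hT.1], ?_⟩
      have := hT.2
      rw [bumpPeriod, show 2 * (2 * Real.pi / (1 - q)) = 4 * (Real.pi / (1 - q)) by ring] at this
      linarith)
  have hcT' : 4 * signQuarterPeriod q c = T := by linarith
  -- Inverts c = 2A^(q-1)/(1+q).
  let A : ℝ := ((1 + q) / 2 * c) ^ (1 / (q - 1))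
  have hB : 0 < (1 + q) / 2 * c := by
    have := hc.1
    positivity
  have hA : 0 < A := Real.rpow_pos_of_pos hB _
  have hAc : amplitudeParam q A = c := by
    have : q - 1 ≠ 0 := by linarith
    simp only [amplitudeParam, A]
    rw [← Real.rpow_mul hB.le, one_div_mul_cancel this, Real.rpow_one]
    field_simp
  obtain ⟨w, hw, hws, horb, hne, hper, hmult⟩ :=
    exists_signChanging_solution hq0 hq1 hA (by rw [hAc]; exact hc.2)
  rw [hAc, hcT'] at hper hmult
  refine ⟨w, ⟨hw, hasLeastPeriod_of_multiples hT0 hper hmult, hws⟩, fun v hv hvT hvs => ?_⟩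
  obtain ⟨t₀, ht₀⟩ := exists_zero_of_isSignChanging hv.1.continuous hvs
  have hE := energy_nonneg_of_zero hq0 hv ht₀
  -- Zero energy would need a period of at least two bumps, which exceeds T. At positive energy,
  -- strict monotonicity makes T determine the amplitude.
  rcases (hE 0).eq_or_lt with h | h
  · have := two_mul_bumpPeriod_le hq0 hq1 hv
      (fun t => by rw [energy_eq hq0 hv t 0, ← h]) hvs hT0 hvT.1.2
    linarith [hT.2]
  · obtain ⟨B, hB, hBc, hBE⟩ := exists_amplitude hq0 hq1 h
    obtain ⟨u, hu, -, horb', hne', hper', hmult'⟩ := exists_signChanging_solution hq0 hq1 hB hBc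
    obtain ⟨τ, hτ⟩ := isTimeShift_of_phase_eq hq0 hv hu hne' (horb' _ _ hBE.symm)
    have hBc' : amplitudeParam q B ∈ Ioo (0 : ℝ) 1 := ⟨amplitudeParam_pos hq0 hB, hBc⟩
    have hleast := hasLeastPeriod_of_multiples
      (by linarith [(signQuarterPeriod_mem_Ioo hq0 hq1 hBc').1]) hper' hmult'
    have hvleast : HasLeastPeriod v (4 * signQuarterPeriod q (amplitudeParam q B)) := by
      refine ⟨⟨hleast.1.1, (periodic_shift_iff hτ).2 hleast.1.2⟩, fun S hS => ?_⟩
      exact hleast.2 ⟨hS.1, (periodic_shift_iff hτ).1 hS.2⟩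
    have hTeq := hvT.unique hvleast
    have hBA : B = A := by
      refine eq_of_amplitudeParam_eq hq0 hq1 hB hA ?_
      rw [hAc]
      refine hm.injOn (Ioo_subset_Icc_self hBc') (Ioo_subset_Icc_self hc) ?_
      linarith
    rw [hBA] at hBE
    exact isTimeShift_of_phase_eq hq0 hv hw hne (horb _ _ hBE.symm)

lemma two_mul_wellHalfPeriod_mem_Ioo (hq0 : 0 < q) (hq1 : q < 1) {r : ℝ}
    (hr : r ∈ Ioo 0 (wellRadius q)) :
    2 * wellHalfPeriod q r ∈ Ioo (2 * Real.pi / √(1 - q)) (bumpPeriod q) := by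
  have hm := (wellHalfPeriod_strictMonoOn_continuousOn hq0 hq1).1
  have hR := (wellRadius_pos hq0 hq1).le
  have h0 := hm (left_mem_Icc.2 hR) (Ioo_subset_Icc_self hr) hr.1
  have h1 := hm (Ioo_subset_Icc_self hr) (right_mem_Icc.2 hR) hr.2
  rw [wellHalfPeriod_zero hq0 hq1] at h0
  rw [(wellHalfPeriod_wellRadius hq0 hq1).2] at h1
  rw [bumpPeriod, mul_div_assoc, mul_div_assoc]
  exact ⟨by linarith, by linarith⟩

/-- Zero energy would make the solution a bump, which vanishes at its ends; positive energy would
make it change sign. -/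
lemma energy_neg_of_pos (hq0 : 0 < q) (hq1 : q < 1) {v : ℝ → ℝ} (hv : IsODESolution 1 1 q v)
    (hpos : ∀ t, 0 < v t) : energy q (v 0) (deriv v 0) < 0 := by
  by_contra! h
  rcases h.eq_or_lt with h | h
  · obtain ⟨σ, -, hσ⟩ := exists_shift_eq_bump hq0 hq1 hv h.symm (hpos 0)
    have h1 := hσ (-σ) (by simpa using (bumpPeriod_pos hq1).le)
    have h2 : bump q (-σ + σ) = 0 := (bump_eq_zero_iff hq0 hq1).2 ⟨0, by simp⟩
    linarith [hpos (-σ)]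
  · obtain ⟨A, hA, hc, hAE⟩ := exists_amplitude hq0 hq1 h
    obtain ⟨w, hw, hs, horb, hne, -, -⟩ := exists_signChanging_solution hq0 hq1 hA hc
    obtain ⟨τ, hτ⟩ := isTimeShift_of_phase_eq hq0 hv hw hne (horb _ _ hAE.symm)
    obtain ⟨t, ht⟩ := hs.2
    have := hpos (t - τ)
    rw [hτ, sub_add_cancel] at this
    linarith

/-- A nonconstant positive solution is an oscillation in the well. -/
lemma exists_radius (hq0 : 0 < q) (hq1 : q < 1) {v : ℝ → ℝ} (hv : IsODESolution 1 1 q v)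
    (hpos : ∀ t, 0 < v t) (hnc : ¬ IsConstantFun v) :
    ∃ r ∈ Ioo 0 (wellRadius q),
      energy q (v 0) (deriv v 0) = potential q 1 + r ^ 2 / 2 := by
  have hneg := energy_neg_of_pos hq0 hq1 hv hpos
  have hR := wellRadius_pos hq0 hq1
  have hR2 := wellRadius_sq hq0 hq1
  have hG : potential q 1 = -(wellRadius q ^ 2 / 2) := by
    rw [hR2, potential, abs_one, Real.one_rpow]
    field_simp
    ring
  have hexc : ∀ t, energy q (v 0) (deriv v 0) - potential q 1
      = deriv v t ^ 2 / 2 + excess q (v t) := fun t => by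
    rw [excess_eq hq0 (hpos t).le, energy_eq hq0 hv 0 t, energy]
    ring
  -- At the minimal energy the excess vanishes identically, so the solution rests at 1.
  have hgt : 0 < energy q (v 0) (deriv v 0) - potential q 1 := by
    by_contra! hle
    refine hnc ⟨1, fun t => ?_⟩
    by_contra hne
    have h1 := excess_pos hq0 hq1 (hpos t).le hne
    have h2 := hexc t
    nlinarith [sq_nonneg (deriv v t)]
  refine ⟨√(2 * (energy q (v 0) (deriv v 0) - potential q 1)), ⟨by positivity, ?_⟩, ?_⟩
  · rw [Real.sqrt_lt' hR]
    linarith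
  · rw [Real.sq_sqrt (by positivity)]
    ring

theorem period_of_positive (hq0 : 0 < q) (hq1 : q < 1) {v : ℝ → ℝ} (hv : IsODESolution 1 1 q v)
    (hpos : ∀ t, 0 < v t) (hnc : ¬ IsConstantFun v) {S : ℝ} (hS : 0 < S)
    (hper : Function.Periodic v S) :
    ∃ T ∈ Ioo (2 * Real.pi / √(1 - q)) (bumpPeriod q), HasLeastPeriod v T ∧
      ∃ n : ℕ, 1 ≤ n ∧ S = n * T := by
  obtain ⟨r, hr, hE⟩ := exists_radius hq0 hq1 hv hpos hnc
  obtain ⟨w, hw, hwpos, horb, hwper, hmult⟩ := exists_positive_solution hq0 hq1 hr.1 hr.2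
  obtain ⟨τ, hτ⟩ := isTimeShift_of_phase_eq hq0 hv hw (fun t => Or.inl (hwpos t).ne')
    (horb _ _ (hpos 0) hE)
  have hT := two_mul_wellHalfPeriod_mem_Ioo hq0 hq1 hr
  have hmult' : ∀ S, 0 < S → Function.Periodic v S →
      ∃ n : ℕ, 1 ≤ n ∧ S = n * (2 * wellHalfPeriod q r) := fun S hS hSp =>
    hmult S hS ((periodic_shift_iff hτ).1 hSp)
  refine ⟨_, hT, hasLeastPeriod_of_multiples (lt_of_le_of_lt (by positivity) hT.1)
    ((periodic_shift_iff hτ).2 hwper) hmult', hmult' S hS hper⟩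

theorem existsUnique_positive (hq0 : 0 < q) (hq1 : q < 1) {T : ℝ}
    (hT : T ∈ Ioo (2 * Real.pi / √(1 - q)) (bumpPeriod q)) :
    ∃ w : ℝ → ℝ, (IsODESolution 1 1 q w ∧ HasLeastPeriod w T ∧ ∀ t, 0 < w t) ∧
      ∀ v : ℝ → ℝ, IsODESolution 1 1 q v → HasLeastPeriod v T → (∀ t, 0 < v t) →
        IsTimeShift v w := by
  have hT0 : 0 < T := lt_of_le_of_lt (by positivity) hT.1
  obtain ⟨hm, hcont⟩ := wellHalfPeriod_strictMonoOn_continuousOn hq0 hq1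
  obtain ⟨r, hr, hrT⟩ := intermediate_value_Ioo (wellRadius_pos hq0 hq1).le hcont
    (show T / 2 ∈ Ioo (wellHalfPeriod q 0) (wellHalfPeriod q (wellRadius q)) by
      rw [wellHalfPeriod_zero hq0 hq1, (wellHalfPeriod_wellRadius hq0 hq1).2]
      rw [bumpPeriod, mul_div_assoc, mul_div_assoc] at hT
      exact ⟨by linarith [hT.1], by linarith [hT.2]⟩)
  have hrT' : 2 * wellHalfPeriod q r = T := by linarith
  obtain ⟨w, hw, hwpos, horb, hwper, hmult⟩ := exists_positive_solution hq0 hq1 hr.1 hr.2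
  rw [hrT'] at hwper hmult
  refine ⟨w, ⟨hw, hasLeastPeriod_of_multiples hT0 hwper hmult, hwpos⟩, fun v hv hvT hvpos => ?_⟩
  obtain ⟨s, hs, hE⟩ := exists_radius hq0 hq1 hv hvpos (not_isConstantFun_of_hasLeastPeriod hvT)
  obtain ⟨u, hu, hupos, horb', huper, hmult'⟩ := exists_positive_solution hq0 hq1 hs.1 hs.2
  obtain ⟨τ, hτ⟩ := isTimeShift_of_phase_eq hq0 hv hu (fun t => Or.inl (hupos t).ne')
    (horb' _ _ (hvpos 0) hE)
  have hleast : HasLeastPeriod v (2 * wellHalfPeriod q s) :=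
    hasLeastPeriod_of_multiples
      (lt_of_le_of_lt (by positivity) (two_mul_wellHalfPeriod_mem_Ioo hq0 hq1 hs).1)
      ((periodic_shift_iff hτ).2 huper)
      (fun S hS hSp => hmult' S hS ((periodic_shift_iff hτ).1 hSp))
  have hTeq := hvT.unique hleast
  have hrs : s = r :=
    hm.injOn (Ioo_subset_Icc_self hs) (Ioo_subset_Icc_self hr) (by linarith)
  rw [hrs] at hE
  exact isTimeShift_of_phase_eq hq0 hv hw (fun t => Or.inl (hwpos t).ne')
    (horb _ _ (hvpos 0) hE)

lemma hasLeastPeriod_bump (hq0 : 0 < q) (hq1 : q < 1) :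
    HasLeastPeriod (bump q) (bumpPeriod q) := by
  have hL := bumpPeriod_pos hq1
  refine hasLeastPeriod_of_multiples hL (bump_add_period hq1) fun S hS hSp => ?_
  have h0 : bump q 0 = 0 := (bump_eq_zero_iff hq0 hq1).2 ⟨0, by simp⟩
  have h1 := hSp 0
  rw [zero_add, h0] at h1
  obtain ⟨n, hn⟩ := (bump_eq_zero_iff hq0 hq1).1 h1
  have h2 : (0 : ℝ) < n := pos_of_mul_pos_left (by rw [← hn]; exact hS) hL.le
  have h3 : 0 < n := by exact_mod_cast h2
  obtain ⟨m, rfl⟩ := Int.eq_ofNat_of_zero_le h3.le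
  exact ⟨m, by omega, by simpa using hn⟩

theorem isTimeShift_bump (hq0 : 0 < q) (hq1 : q < 1) {v : ℝ → ℝ} (hv : IsODESolution 1 1 q v)
    (hT : HasLeastPeriod v (bumpPeriod q)) (hnn : ∀ t, 0 ≤ v t) : IsTimeShift v (bump q) := by
  have hL := bumpPeriod_pos hq1
  have hnc := not_isConstantFun_of_hasLeastPeriod hT
  have hz : ∃ t, v t = 0 := by
    -- A strictly positive solution would have least period strictly below that of `bump`.
    by_contra! h
    have hpos : ∀ t, 0 < v t := fun t => lt_of_le_of_ne (hnn t) (h t).symm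
    obtain ⟨T, hT', hleast, -⟩ := period_of_positive hq0 hq1 hv hpos hnc hL hT.1.2
    have := hT.unique hleast
    linarith [hT'.2]
  obtain ⟨t₁, ht₁⟩ := hz
  have hd : deriv v t₁ = 0 :=
    IsLocalMin.deriv_eq_zero (Eventually.of_forall fun s => by rw [ht₁]; exact hnn s)
  have hE : ∀ t, energy q (v t) (deriv v t) = 0 := fun t => by
    rw [energy_eq hq0 hv t t₁, ht₁, hd, energy, potential_zero hq0]
    simp
  obtain ⟨t₀, ht₀⟩ : ∃ t, 0 < v t := by
    by_contra! h
    exact hnc ⟨0, fun t => le_antisymm (h t) (hnn t)⟩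
  obtain ⟨σ, -, hσ⟩ := exists_shift_eq_bump hq0 hq1 hv (hE t₀) ht₀
  refine ⟨σ, fun t => ?_⟩
  -- The two functions are known to agree on one period only. Uniqueness fails at the zeros, so the
  -- rest comes from the common period.
  obtain ⟨n, hn, -⟩ := existsUnique_add_zsmul_mem_Ico hL t (-σ)
  have hWp : Function.Periodic (bump q) (bumpPeriod q) := bump_add_period hq1
  have h1 : v (t + n • bumpPeriod q) = v t := hT.1.2.zsmul n t
  have h2 : bump q (t + σ + n • bumpPeriod q) = bump q (t + σ) := hWp.zsmul n (t + σ)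
  rw [← h1, ← h2, hσ _ ⟨by linarith [hn.1], by linarith [hn.2]⟩]
  congr 1
  ring

lemma existsUnique_bump_eq_zero (hq0 : 0 < q) (hq1 : q < 1) (a : ℝ) :
    ∃! t, t ∈ Ico a (a + bumpPeriod q) ∧ bump q t = 0 := by
  obtain ⟨n, hn, huniq⟩ := existsUnique_add_zsmul_mem_Ico (bumpPeriod_pos hq1) 0 a
  simp only [zero_add, zsmul_eq_mul] at hn huniq
  refine ⟨n * bumpPeriod q, ⟨hn, (bump_eq_zero_iff hq0 hq1).2 ⟨n, rfl⟩⟩, ?_⟩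
  rintro t ⟨ht, ht0⟩
  obtain ⟨m, rfl⟩ := (bump_eq_zero_iff hq0 hq1).1 ht0
  rw [huniq m ht]

lemma phaseOrbit_bump (hq0 : 0 < q) (hq1 : q < 1) :
    phaseOrbit (bump q) = {p : ℝ × ℝ | 0 ≤ p.1 ∧ energy q p.1 p.2 = 0} := by
  ext ⟨x, y⟩
  simp only [phaseOrbit, mem_range, mem_ofPred_eq, Prod.mk.injEq]
  constructor
  · rintro ⟨t, rfl, rfl⟩
    exact ⟨bump_nonneg hq0 t, energy_bump hq0 hq1 t⟩
  · rintro ⟨hx, hE⟩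
    rcases hx.eq_or_lt with rfl | hx
    · have hy : y = 0 := by
        rw [energy, potential_zero hq0] at hE
        nlinarith
      have h0 : bump q 0 = 0 := (bump_eq_zero_iff hq0 hq1).2 ⟨0, by simp⟩
      refine ⟨0, h0, ?_⟩
      rw [hy]
      exact IsLocalMin.deriv_eq_zero
        (Eventually.of_forall fun s => by rw [h0]; exact bump_nonneg hq0 s)
    · obtain ⟨t, -, h1, h2⟩ := exists_bump_eq hq0 hq1 hx hE
      exact ⟨t, h1, h2⟩

/-! ### Rescaling -/

/-- The change of units `w ↦ a w(m ·)`. -/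
def rescale (a m : ℝ) (w : ℝ → ℝ) : ℝ → ℝ := fun t => a * w (m * t)

section Rescale

variable {a m : ℝ} {v w : ℝ → ℝ}

lemma rescale_rescale_inv (ha : a ≠ 0) (hm : m ≠ 0) (w : ℝ → ℝ) :
    rescale a m (rescale a⁻¹ m⁻¹ w) = w := by
  funext t
  simp only [rescale]
  rw [inv_mul_cancel_left₀ hm, mul_inv_cancel_left₀ ha]

lemma deriv_rescale (a m : ℝ) (w : ℝ → ℝ) (t : ℝ) :
    deriv (rescale a m w) t = a * m * deriv w (m * t) := by
  have h := deriv_comp_mul_left m w t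
  change deriv (fun t => a * w (m * t)) t = _
  rw [deriv_const_mul_field, h, smul_eq_mul]
  ring

/-- The linear terms scale by a m² and the nonlinear one by a^q; the hypothesis on a and m makes
these equal. -/
lemma isODESolution_rescale {μ : ℝ} (ha : 0 < a) (hm : m ^ 2 * a ^ (1 - q) = 1)
    (hw : IsODESolution μ 1 q w) : IsODESolution (m ^ 2 * μ) 1 q (rescale a m w) := by
  refine ⟨contDiff_const.mul (hw.1.comp (contDiff_const.mul contDiff_id)), fun t => ?_⟩
  have h1 : deriv (rescale a m w) = rescale (a * m) m (deriv w) :=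
    funext fun t => deriv_rescale a m w t
  rw [h1, deriv_rescale]
  simp only [rescale]
  have h2 := hw.2 (m * t)
  rw [abs_mul, abs_of_pos ha, Real.mul_rpow ha.le (abs_nonneg _)]
  have h3 : a ^ (1 - q) * a ^ (q - 1) = 1 := by
    rw [← Real.rpow_add ha]
    simp
  have h4 : a ^ (q - 1) = m ^ 2 := by
    have hne : a ^ (1 - q) ≠ 0 := (Real.rpow_pos_of_pos ha _).ne'
    apply mul_left_cancel₀ hne
    rw [h3, mul_comm, hm]
  rw [h4]
  linear_combination (a * m ^ 2) * h2

lemma periodic_rescale_iff (ha : a ≠ 0) (hm : m ≠ 0) {S : ℝ} :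
    Function.Periodic (rescale a m w) S ↔ Function.Periodic w (m * S) := by
  refine ⟨fun h t => ?_, fun h t => ?_⟩
  · have := h (t / m)
    simp only [rescale, mul_add, mul_div_cancel₀ t hm] at this
    exact mul_left_cancel₀ ha this
  · simp only [rescale, mul_add, h (m * t)]

lemma hasLeastPeriod_rescale (ha : a ≠ 0) (hm : 0 < m) {T : ℝ} (h : HasLeastPeriod w T) :
    HasLeastPeriod (rescale a m w) (T / m) := by
  refine ⟨⟨div_pos h.1.1 hm, ?_⟩, fun S hS => ?_⟩
  · rw [periodic_rescale_iff ha hm.ne', mul_div_cancel₀ T hm.ne']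
    exact h.1.2
  · rw [div_le_iff₀ hm, mul_comm]
    exact h.2 ⟨mul_pos hm hS.1, (periodic_rescale_iff ha hm.ne').1 hS.2⟩

lemma isSignChanging_rescale (ha : 0 < a) (hm : m ≠ 0) (h : IsSignChanging w) :
    IsSignChanging (rescale a m w) := by
  obtain ⟨⟨s, hs⟩, t, ht⟩ := h
  refine ⟨⟨s / m, ?_⟩, t / m, ?_⟩ <;> simp only [rescale, mul_div_cancel₀ _ hm]
  · exact mul_pos ha hs
  · exact mul_neg_of_pos_of_neg ha ht

lemma not_isConstantFun_rescale (ha : a ≠ 0) (hm : m ≠ 0) (h : ¬ IsConstantFun w) :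
    ¬ IsConstantFun (rescale a m w) := by
  rintro ⟨b, hb⟩
  refine h ⟨b / a, fun t => ?_⟩
  have := hb (t / m)
  simp only [rescale, mul_div_cancel₀ _ hm] at this
  rw [← this, mul_div_cancel_left₀ _ ha]

lemma isTimeShift_rescale (hm : m ≠ 0) (h : IsTimeShift v w) :
    IsTimeShift (rescale a m v) (rescale a m w) := by
  obtain ⟨τ, hτ⟩ := h
  refine ⟨τ / m, fun t => ?_⟩
  simp only [rescale, hτ, mul_add, mul_div_cancel₀ _ hm]

end Rescale

/-- The length scale that turns the coefficient `1` into `μ`. -/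
noncomputable def lengthScale (μ q : ℝ) : ℝ := (μ⁻¹) ^ (1 / (1 - q))

/-! ### The results for general μ -/

section General

variable {μ : ℝ} {w : ℝ → ℝ}

lemma lengthScale_pos (hμ : 0 < μ) : 0 < lengthScale μ q := by
  rw [lengthScale]
  positivity

lemma lengthScale_rpow (hμ : 0 < μ) (hq1 : q < 1) : lengthScale μ q ^ (1 - q) = μ⁻¹ := by
  have : 1 - q ≠ 0 := by linarith
  rw [lengthScale, ← Real.rpow_mul (by positivity), one_div_mul_cancel this, Real.rpow_one]

lemma isODESolution_rescale_up (hμ : 0 < μ) (hq1 : q < 1) (hw : IsODESolution 1 1 q w) :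
    IsODESolution μ 1 q (rescale (lengthScale μ q) (√μ) w) := by
  have h := isODESolution_rescale (m := √μ) (lengthScale_pos hμ)
    (by rw [lengthScale_rpow hμ hq1, Real.sq_sqrt hμ.le, mul_inv_cancel₀ hμ.ne']) hw
  rwa [Real.sq_sqrt hμ.le, mul_one] at h

lemma isODESolution_rescale_down (hμ : 0 < μ) (hq1 : q < 1) (hw : IsODESolution μ 1 q w) :
    IsODESolution 1 1 q (rescale (lengthScale μ q)⁻¹ (√μ)⁻¹ w) := by
  have h := isODESolution_rescale (m := (√μ)⁻¹) (inv_pos.2 (lengthScale_pos (q := q) hμ))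
    (by rw [Real.inv_rpow (lengthScale_pos hμ).le, lengthScale_rpow hμ hq1, inv_inv, inv_pow,
      Real.sq_sqrt hμ.le, inv_mul_cancel₀ hμ.ne']) hw
  rwa [inv_pow, Real.sq_sqrt hμ.le, inv_mul_cancel₀ hμ.ne'] at h

lemma hasLeastPeriod_rescale_up (hμ : 0 < μ) {T : ℝ} (h : HasLeastPeriod w (√μ * T)) :
    HasLeastPeriod (rescale (lengthScale μ q) (√μ) w) T := by
  have hm : 0 < √μ := Real.sqrt_pos.2 hμ
  have := hasLeastPeriod_rescale (lengthScale_pos (q := q) hμ).ne' hm h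
  rwa [mul_div_cancel_left₀ _ hm.ne'] at this

lemma hasLeastPeriod_rescale_down (hμ : 0 < μ) {T : ℝ} (h : HasLeastPeriod w T) :
    HasLeastPeriod (rescale (lengthScale μ q)⁻¹ (√μ)⁻¹ w) (√μ * T) := by
  have hm : 0 < √μ := Real.sqrt_pos.2 hμ
  have := hasLeastPeriod_rescale (inv_pos.2 (lengthScale_pos (q := q) hμ)).ne' (inv_pos.2 hm) h
  rwa [div_inv_eq_mul, mul_comm] at this

lemma periodic_rescale_down (hμ : 0 < μ) {S : ℝ} (h : Function.Periodic w S) :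
    Function.Periodic (rescale (lengthScale μ q)⁻¹ (√μ)⁻¹ w) (√μ * S) := by
  have hm : 0 < √μ := Real.sqrt_pos.2 hμ
  rw [periodic_rescale_iff (inv_pos.2 (lengthScale_pos (q := q) hμ)).ne' (inv_pos.2 hm).ne',
    inv_mul_cancel_left₀ hm.ne']
  exact h

lemma isTimeShift_rescale_up (hμ : 0 < μ) {v : ℝ → ℝ}
    (h : IsTimeShift (rescale (lengthScale μ q)⁻¹ (√μ)⁻¹ v) w) :
    IsTimeShift v (rescale (lengthScale μ q) (√μ) w) := by
  have hm : 0 < √μ := Real.sqrt_pos.2 hμ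
  have := isTimeShift_rescale (a := lengthScale μ q) hm.ne' h
  rwa [rescale_rescale_inv (lengthScale_pos hμ).ne' hm.ne'] at this

lemma rescale_up_pos (hμ : 0 < μ) (h : ∀ t, 0 < w t) (t : ℝ) :
    0 < rescale (lengthScale μ q) (√μ) w t :=
  mul_pos (lengthScale_pos hμ) (h _)

lemma rescale_down_pos (hμ : 0 < μ) (h : ∀ t, 0 < w t) (t : ℝ) :
    0 < rescale (lengthScale μ q)⁻¹ (√μ)⁻¹ w t :=
  mul_pos (inv_pos.2 (lengthScale_pos hμ)) (h _)

theorem existsUnique_signChanging_of_lt (hμ : 0 < μ) (hq0 : 0 < q) (hq1 : q < 1) {k : ℕ}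
    (h1 : (1 - q) / 2 * √μ < k) (h2 : (k : ℝ) < √μ) :
    ∃ w : ℝ → ℝ, (IsODESolution μ 1 q w ∧ IsOfMode w k ∧ IsSignChanging w) ∧
      ∀ v : ℝ → ℝ, IsODESolution μ 1 q v → IsOfMode v k → IsSignChanging v →
        IsTimeShift v w := by
  have hm : 0 < √μ := Real.sqrt_pos.2 hμ
  have hδ : 0 < 1 - q := by linarith
  have hπ := Real.pi_pos
  have hk : 0 < (k : ℝ) := lt_of_le_of_lt (by positivity) h1
  have hT : √μ * (2 * Real.pi / k) ∈ Ioo (2 * Real.pi) (2 * bumpPeriod q) := by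
    rw [bumpPeriod, mul_div_assoc', mul_div_assoc']
    constructor
    · rw [lt_div_iff₀ hk]
      nlinarith
    · rw [div_lt_div_iff₀ hk hδ]
      nlinarith
  obtain ⟨w, ⟨hw, hwT, hws⟩, huniq⟩ := existsUnique_signChanging hq0 hq1 hT
  refine ⟨rescale (lengthScale μ q) (√μ) w, ⟨isODESolution_rescale_up hμ hq1 hw,
    hasLeastPeriod_rescale_up hμ hwT, isSignChanging_rescale (lengthScale_pos hμ) hm.ne' hws⟩,
    fun v hv hvT hvs => isTimeShift_rescale_up hμ (huniq _ (isODESolution_rescale_down hμ hq1 hv)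
      (hasLeastPeriod_rescale_down hμ hvT)
      (isSignChanging_rescale (inv_pos.2 (lengthScale_pos hμ)) (inv_pos.2 hm).ne' hvs))⟩

theorem exists_signChanging_periodic_iff (hμ : 0 < μ) (hq0 : 0 < q) (hq1 : q < 1) :
    (∃ w : ℝ → ℝ, IsODESolution μ 1 q w ∧ Function.Periodic w (2 * Real.pi) ∧
        ¬ IsConstantFun w ∧ IsSignChanging w) ↔ 1 < μ := by
  have hm : 0 < √μ := Real.sqrt_pos.2 hμ
  have hδ : 0 < 1 - q := by linarith
  have hπ := Real.pi_pos
  constructor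
  · rintro ⟨w, hw, hper, -, hs⟩
    have := two_pi_lt_of_isSignChanging hq0 hq1 (isODESolution_rescale_down hμ hq1 hw)
      (isSignChanging_rescale (inv_pos.2 (lengthScale_pos hμ)) (inv_pos.2 hm).ne' hs)
      (by positivity) (periodic_rescale_down hμ hper)
    have h1 : 1 < √μ := by
      by_contra! h
      nlinarith
    rw [← Real.sq_sqrt hμ.le]
    nlinarith
  · intro h
    have h1 : 1 < √μ := by
      rw [Real.lt_sqrt zero_le_one]
      simpa using h
    -- If the left end ℓ = (1-q)√μ/2 is below 1, take k = 1. Otherwise ⌊ℓ⌋ + 1 ≤ 2ℓ = (1-q)√μ < √μ.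
    obtain ⟨k, hk1, hk2⟩ : ∃ k : ℕ, (1 - q) / 2 * √μ < k ∧ (k : ℝ) < √μ := by
      rcases lt_or_ge ((1 - q) / 2 * √μ) 1 with h2 | h2
      · exact ⟨1, by simpa using h2, by simpa using h1⟩
      · refine ⟨⌊(1 - q) / 2 * √μ⌋₊ + 1, ?_, ?_⟩
        · push_cast
          exact Nat.lt_floor_add_one _
        · push_cast
          have := Nat.floor_le (by positivity : 0 ≤ (1 - q) / 2 * √μ)
          nlinarith
    obtain ⟨w, ⟨hw, hwk, hws⟩, -⟩ := existsUnique_signChanging_of_lt hμ hq0 hq1 hk1 hk2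
    have hk : (k : ℝ) ≠ 0 := (lt_of_le_of_lt (by positivity) hk1).ne'
    refine ⟨w, hw, ?_, not_isConstantFun_of_hasLeastPeriod hwk, hws⟩
    have := hwk.1.2.nat_mul k
    rwa [mul_div_cancel₀ _ hk] at this

lemma mem_Ioo_iff_mode (hμ : 0 < μ) (hq1 : q < 1) {k : ℝ} (hk : 0 < k) :
    √μ * (2 * Real.pi / k) ∈ Ioo (2 * Real.pi / √(1 - q)) (bumpPeriod q) ↔
      (1 - q) * √μ < k ∧ k < √(μ * (1 - q)) := by
  have hδ : 0 < 1 - q := by linarith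
  have hs : 0 < √(1 - q) := Real.sqrt_pos.2 hδ
  have hπ := Real.pi_pos
  rw [bumpPeriod, mul_div_assoc', mem_Ioo, div_lt_div_iff₀ hs hk, div_lt_div_iff₀ hk hδ,
    Real.sqrt_mul hμ.le, and_comm]
  refine and_congr ⟨fun h => ?_, fun h => ?_⟩ ⟨fun h => ?_, fun h => ?_⟩ <;> nlinarith

theorem existsUnique_positive_of_lt (hμ : 0 < μ) (hq0 : 0 < q) (hq1 : q < 1) {k : ℕ}
    (h1 : (1 - q) * √μ < k) (h2 : (k : ℝ) < √(μ * (1 - q))) :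
    ∃ w : ℝ → ℝ, (IsODESolution μ 1 q w ∧ IsOfMode w k ∧ ∀ t, 0 < w t) ∧
      ∀ v : ℝ → ℝ, IsODESolution μ 1 q v → IsOfMode v k → (∀ t, 0 < v t) →
        IsTimeShift v w := by
  have hδ : 0 < 1 - q := by linarith
  have hk : 0 < (k : ℝ) := lt_of_le_of_lt (by positivity) h1
  obtain ⟨w, ⟨hw, hwT, hws⟩, huniq⟩ :=
    existsUnique_positive hq0 hq1 ((mem_Ioo_iff_mode hμ hq1 hk).2 ⟨h1, h2⟩)
  exact ⟨rescale (lengthScale μ q) (√μ) w, ⟨isODESolution_rescale_up hμ hq1 hw,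
    hasLeastPeriod_rescale_up hμ hwT, rescale_up_pos hμ hws⟩,
    fun v hv hvT hvs => isTimeShift_rescale_up hμ (huniq _ (isODESolution_rescale_down hμ hq1 hv)
      (hasLeastPeriod_rescale_down hμ hvT) (rescale_down_pos hμ hvs))⟩

/-- After rescaling, the given period is n times the least one; this n is the mode, and the range of
least periods gives its bounds. -/
theorem lt_of_positive_periodic (hμ : 0 < μ) (hq0 : 0 < q) (hq1 : q < 1)
    (hw : IsODESolution μ 1 q w) (hpos : ∀ t, 0 < w t) (hnc : ¬ IsConstantFun w)
    (hper : Function.Periodic w (2 * Real.pi)) :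
    ∃ n : ℕ, IsOfMode w n ∧ (1 - q) * √μ < n ∧ (n : ℝ) < √(μ * (1 - q)) := by
  have hm : 0 < √μ := Real.sqrt_pos.2 hμ
  have ha := lengthScale_pos (q := q) hμ
  obtain ⟨T, hT, hleast, n, hn, hnT⟩ := period_of_positive hq0 hq1
    (isODESolution_rescale_down hμ hq1 hw) (rescale_down_pos hμ hpos)
    (not_isConstantFun_rescale (inv_pos.2 ha).ne' (inv_pos.2 hm).ne' hnc) (by positivity)
    (periodic_rescale_down hμ hper)
  have hn' : 0 < (n : ℝ) := by exact_mod_cast hn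
  have hTn : T = √μ * (2 * Real.pi / n) := by
    field_simp
    linarith
  rw [hTn] at hT hleast
  refine ⟨n, ?_, (mem_Ioo_iff_mode hμ hq1 hn').1 hT⟩
  have := hasLeastPeriod_rescale_up (q := q) hμ hleast
  rwa [rescale_rescale_inv ha.ne' hm.ne'] at this

lemma mode_unique {k n : ℕ} (hk : IsOfMode w k) (hn : IsOfMode w n) : k = n := by
  have h := IsLeast.unique hk hn
  have hπ := Real.pi_pos
  have hk0 := hk.1.1
  have hn0 := hn.1.1
  have hk' : (k : ℝ) ≠ 0 := fun h0 => by simp [h0] at hk0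
  have hn' : (n : ℝ) ≠ 0 := fun h0 => by simp [h0] at hn0
  have : (k : ℝ) = n := by
    field_simp at h
    exact h.symm
  exact_mod_cast this

lemma periodic_two_pi_of_isOfMode {k : ℕ} (hk : IsOfMode w k) :
    Function.Periodic w (2 * Real.pi) := by
  have hk0 := hk.1.1
  have hk' : (k : ℝ) ≠ 0 := fun h0 => by simp [h0] at hk0
  have := hk.1.2.nat_mul k
  rwa [mul_div_cancel₀ _ hk'] at this

theorem exists_positive_mode_iff (hμ : 0 < μ) (hq0 : 0 < q) (hq1 : q < 1) (k : ℕ) :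
    (∃ w : ℝ → ℝ, IsODESolution μ 1 q w ∧ IsOfMode w k ∧ ∀ t, 0 < w t) ↔
      (1 - q) * √μ < k ∧ (k : ℝ) < √(μ * (1 - q)) := by
  constructor
  · rintro ⟨w, hw, hk, hpos⟩
    obtain ⟨n, hn, h⟩ := lt_of_positive_periodic hμ hq0 hq1 hw hpos
      (not_isConstantFun_of_hasLeastPeriod hk) (periodic_two_pi_of_isOfMode hk)
    rwa [mode_unique hk hn]
  · rintro ⟨h1, h2⟩
    obtain ⟨w, hw, -⟩ := existsUnique_positive_of_lt hμ hq0 hq1 h1 h2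
    exact ⟨w, hw⟩

theorem exists_positive_periodic_iff (hμ : 0 < μ) (hq0 : 0 < q) (hq1 : q < 1) :
    (∃ w : ℝ → ℝ, IsODESolution μ 1 q w ∧ Function.Periodic w (2 * Real.pi) ∧
        ¬ IsConstantFun w ∧ ∀ t, 0 < w t) ↔
      ∃ k : ℕ, (1 - q) * √μ < k ∧ (k : ℝ) < √(μ * (1 - q)) := by
  constructor
  · rintro ⟨w, hw, hper, hnc, hpos⟩
    obtain ⟨n, -, h⟩ := lt_of_positive_periodic hμ hq0 hq1 hw hpos hnc hper
    exact ⟨n, h⟩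
  · rintro ⟨k, h1, h2⟩
    obtain ⟨w, ⟨hw, hk, hpos⟩, -⟩ := existsUnique_positive_of_lt hμ hq0 hq1 h1 h2
    exact ⟨w, hw, periodic_two_pi_of_isOfMode hk, not_isConstantFun_of_hasLeastPeriod hk, hpos⟩

lemma phaseOrbit_rescale_bump (hμ : 0 < μ) (hq0 : 0 < q) (hq1 : q < 1) :
    phaseOrbit (rescale (lengthScale μ q) (√μ) (bump q)) =
      {p : ℝ × ℝ | 0 ≤ p.1 ∧ p.2 ^ 2 + μ * p.1 ^ 2 = 2 / (1 + q) * |p.1| ^ (1 + q)} := by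
  have hm : 0 < √μ := Real.sqrt_pos.2 hμ
  have ha := lengthScale_pos (q := q) hμ
  have hsq := Real.sq_sqrt hμ.le
  have hpow : μ * lengthScale μ q ^ 2 = lengthScale μ q ^ (1 + q) := by
    have h1 : lengthScale μ q ^ (1 + q) * lengthScale μ q ^ (1 - q) = lengthScale μ q ^ 2 := by
      rw [← Real.rpow_add ha, ← Real.rpow_natCast]
      congr 1
      push_cast
      ring
    rw [← h1, lengthScale_rpow hμ hq1]
    field_simp
  -- Rescaling multiplies the energy by a constant, so the zero level for μ = 1 goes to the claimed
  -- curve.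
  have key : ∀ x y : ℝ, 2 * (lengthScale μ q * √μ) ^ 2 * energy q x y
      = (lengthScale μ q * √μ * y) ^ 2 + μ * (lengthScale μ q * x) ^ 2
        - 2 / (1 + q) * |lengthScale μ q * x| ^ (1 + q) := fun x y => by
    rw [abs_mul, abs_of_pos ha, Real.mul_rpow ha.le (abs_nonneg _), ← hpow, energy, potential,
      mul_pow, mul_pow, hsq]
    field_simp
    rw [hsq]
    ring
  have hc : 0 < 2 * (lengthScale μ q * √μ) ^ 2 := by positivity
  have horb := phaseOrbit_bump hq0 hq1
  ext ⟨x, y⟩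
  constructor
  · rintro ⟨t, ht⟩
    simp only [deriv_rescale, Prod.mk.injEq, rescale] at ht
    obtain ⟨rfl, rfl⟩ := ht
    refine ⟨mul_nonneg ha.le (bump_nonneg hq0 _), ?_⟩
    have := key (bump q (√μ * t)) (deriv (bump q) (√μ * t))
    rw [energy_bump hq0 hq1, mul_zero] at this
    exact sub_eq_zero.1 this.symm
  · rintro ⟨hx, hxy⟩
    simp only at hx hxy
    have h1 : (x / lengthScale μ q, y / (lengthScale μ q * √μ)) ∈ phaseOrbit (bump q) := by
      rw [horb]
      refine ⟨div_nonneg hx ha.le, ?_⟩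
      have := key (x / lengthScale μ q) (y / (lengthScale μ q * √μ))
      rw [mul_div_cancel₀ _ ha.ne', mul_div_cancel₀ _ (by positivity), hxy, sub_self] at this
      exact (mul_eq_zero.1 this).resolve_left hc.ne'
    obtain ⟨s, hs⟩ := h1
    simp only [Prod.mk.injEq] at hs
    refine ⟨s / √μ, ?_⟩
    simp only [deriv_rescale, Prod.mk.injEq, rescale]
    rw [mul_div_cancel₀ _ hm.ne', hs.1, hs.2, mul_div_cancel₀ _ ha.ne',
      mul_div_cancel₀ _ (by positivity)]
    exact ⟨rfl, rfl⟩

theorem existsUnique_nonneg_with_zeros (hμ : 0 < μ) (hq0 : 0 < q) (hq1 : q < 1) :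
    ∃ w : ℝ → ℝ,
      (IsODESolution μ 1 q w ∧ HasLeastPeriod w (2 * Real.pi / ((1 - q) * √μ)) ∧
        ∀ t : ℝ, 0 ≤ w t) ∧
      (∀ v : ℝ → ℝ, IsODESolution μ 1 q v →
        HasLeastPeriod v (2 * Real.pi / ((1 - q) * √μ)) → (∀ t : ℝ, 0 ≤ v t) →
          IsTimeShift v w) ∧
      (∀ a : ℝ, ∃! t : ℝ, t ∈ Set.Ico a (a + 2 * Real.pi / ((1 - q) * √μ)) ∧ w t = 0) ∧
      phaseOrbit w =
        {p : ℝ × ℝ | 0 ≤ p.1 ∧ p.2 ^ 2 + μ * p.1 ^ 2 = 2 / (1 + q) * |p.1| ^ (1 + q)} := by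
  have hm : 0 < √μ := Real.sqrt_pos.2 hμ
  have hδ : 0 < 1 - q := by linarith
  have ha := lengthScale_pos (q := q) hμ
  have hL : √μ * (2 * Real.pi / ((1 - q) * √μ)) = bumpPeriod q := by
    rw [bumpPeriod]
    field_simp
  refine ⟨rescale (lengthScale μ q) (√μ) (bump q), ⟨isODESolution_rescale_up hμ hq1
    (isODESolution_bump hq0 hq1), hasLeastPeriod_rescale_up hμ
    (by rw [hL]; exact hasLeastPeriod_bump hq0 hq1),
    fun t => mul_nonneg ha.le (bump_nonneg hq0 _)⟩, fun v hv hvT hvn => ?_, fun b => ?_,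
    phaseOrbit_rescale_bump hμ hq0 hq1⟩
  · refine isTimeShift_rescale_up hμ (isTimeShift_bump hq0 hq1
      (isODESolution_rescale_down hμ hq1 hv) ?_ fun t => mul_nonneg (inv_pos.2 ha).le (hvn _))
    rw [← hL]
    exact hasLeastPeriod_rescale_down hμ hvT
  · have hIco : ∀ t, t ∈ Ico b (b + 2 * Real.pi / ((1 - q) * √μ)) ↔
        √μ * t ∈ Ico (√μ * b) (√μ * b + bumpPeriod q) := fun t => by
      rw [← hL, ← mul_add, mem_Ico, mem_Ico, mul_le_mul_iff_right₀ hm, mul_lt_mul_iff_right₀ hm]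
    have hzero : ∀ t, rescale (lengthScale μ q) (√μ) (bump q) t = 0 ↔ bump q (√μ * t) = 0 :=
      fun t => by rw [rescale, mul_eq_zero, or_iff_right ha.ne']
    obtain ⟨s, ⟨hs1, hs2⟩, huniq⟩ := existsUnique_bump_eq_zero hq0 hq1 (√μ * b)
    refine ⟨s / √μ, ⟨?_, ?_⟩, fun t ht => ?_⟩
    · rw [hIco, mul_div_cancel₀ _ hm.ne']
      exact hs1
    · rw [hzero, mul_div_cancel₀ _ hm.ne']
      exact hs2
    · rw [eq_div_iff hm.ne', mul_comm]
      exact huniq _ ⟨(hIco t).1 ht.1, (hzero t).1 ht.2⟩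

end General

end SublinearOscillator

theorem proposition3p14 (μ q : ℝ) (hμ : 0 < μ) (hq0 : 0 < q) (hq1 : q < 1) :
    -- sign-changing solutions
    ((∃ w : ℝ → ℝ, IsODESolution μ 1 q w ∧ Function.Periodic w (2 * Real.pi) ∧
        ¬ IsConstantFun w ∧ IsSignChanging w) ↔ 1 < μ) ∧
    (∀ k : ℕ, (1 - q) / 2 * √μ < k → (k : ℝ) < √μ →
      ∃ w : ℝ → ℝ, (IsODESolution μ 1 q w ∧ IsOfMode w k ∧ IsSignChanging w) ∧
        ∀ v : ℝ → ℝ, IsODESolution μ 1 q v → IsOfMode v k → IsSignChanging v →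
          IsTimeShift v w ∨ IsTimeShift v (-w)) ∧
    -- positive solutions
    ((∃ w : ℝ → ℝ, IsODESolution μ 1 q w ∧ Function.Periodic w (2 * Real.pi) ∧
        ¬ IsConstantFun w ∧ ∀ t : ℝ, 0 < w t) ↔
      ∃ k : ℕ, (1 - q) * √μ < k ∧ (k : ℝ) < √(μ * (1 - q))) ∧
    (∀ k : ℕ, (∃ w : ℝ → ℝ, IsODESolution μ 1 q w ∧ IsOfMode w k ∧ ∀ t : ℝ, 0 < w t) ↔
      (1 - q) * √μ < k ∧ (k : ℝ) < √(μ * (1 - q))) ∧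
    (∀ k : ℕ, (1 - q) * √μ < k → (k : ℝ) < √(μ * (1 - q)) →
      ∃ w : ℝ → ℝ, (IsODESolution μ 1 q w ∧ IsOfMode w k ∧ ∀ t : ℝ, 0 < w t) ∧
        ∀ v : ℝ → ℝ, IsODESolution μ 1 q v → IsOfMode v k → (∀ t : ℝ, 0 < v t) →
          IsTimeShift v w) ∧
    -- the nonnegative solution with zeros
    (∃ w : ℝ → ℝ,
      (IsODESolution μ 1 q w ∧ HasLeastPeriod w (2 * Real.pi / ((1 - q) * √μ)) ∧
        ∀ t : ℝ, 0 ≤ w t) ∧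
      (∀ v : ℝ → ℝ, IsODESolution μ 1 q v →
        HasLeastPeriod v (2 * Real.pi / ((1 - q) * √μ)) → (∀ t : ℝ, 0 ≤ v t) →
          IsTimeShift v w) ∧
      (∀ a : ℝ, ∃! t : ℝ, t ∈ Set.Ico a (a + 2 * Real.pi / ((1 - q) * √μ)) ∧ w t = 0) ∧
      phaseOrbit w =
        {p : ℝ × ℝ | 0 ≤ p.1 ∧ p.2 ^ 2 + μ * p.1 ^ 2 = 2 / (1 + q) * |p.1| ^ (1 + q)}) := by
  open SublinearOscillator in
  refine ⟨exists_signChanging_periodic_iff hμ hq0 hq1, fun k h1 h2 => ?_,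
    exists_positive_periodic_iff hμ hq0 hq1, exists_positive_mode_iff hμ hq0 hq1,
    fun k h1 h2 => existsUnique_positive_of_lt hμ hq0 hq1 h1 h2,
    existsUnique_nonneg_with_zeros hμ hq0 hq1⟩
  obtain ⟨w, hw, huniq⟩ := SublinearOscillator.existsUnique_signChanging_of_lt hμ hq0 hq1 h1 h2
  -- The first alternative always holds: the orbit fills its whole level curve, which is symmetric,
  -- so -w is itself a time shift of w.
  exact ⟨w, hw, fun v hv hvk hvs => Or.inl (huniq v hv hvk hvs)⟩
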